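/- Let $(M,g)$ be a smooth Lorentzian manifold of dimension $n\ge 2$ and signature $(-,+,\dots,+)$ that is doubly warped with velocity field $u$: every point has a coordinate neighbourhood with coordinates $(t,\mathbf x)=(t,x^1,\dots,x^{n-1})$ in which $$ds^2=-b^2(\mathbf x)\,dt^2+a^2(t)\,g^\star_{\mu\nu}(\mathbf x)\,dx^\mu dx^\nu ,\qquad u=\frac1{b}\,\frac{\partial}{\partial t}$$ with smooth functions $a>0$, $b>0$ and a smooth Riemannian metric $g^\star$ (so that $u^ku_k=-1$). Let $\nabla$ be the Levi-Civita connection of $g$, denote by a dot the derivative $\dot X=u^k\nabla_kX$ along $u$, so that $\dot u_j=u^k\nabla_ku_j$ is the acceleration, and put $$\varphi=\frac{\nabla_ju^j}{n-1},\qquad \xi=(n-1)(\varphi^2+\dot\varphi).$$ Let $R$ be the curvature scalar of $g$ (with the sign for which round spheres have $R>0$). Then, in every coordinate system of $M$ and at every point of it, $$\nabla_k\xi=-u_k\,\dot\xi-2\,\dot u_k\,\xi ,$$ $$u^k\nabla_k(\nabla_p\dot u^p)=-2\varphi\,\nabla_p\dot u^p ,$$ $$\dot R-2\dot\xi=-2\varphi\,(R-n\xi).$$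 -/

import Mathlib

open scoped Manifold ContDiff Bundle

noncomputable section

namespace DoublyWarped

/-! ### Classical tensor calculus in one coordinate system

The coordinates are `y 0, …, y m`, so the spacetime dimension is `n = m + 1`. A metric is given by
its component functions `G y i j`, a vector field by its contravariant components `U y i`, a
covector field by its covariant components `w y i`. -/

/-- The coordinate space `ℝⁿ`, `n = m + 1`. Index `0` is reserved for time in comoving charts. -/
abbrev Coord (m : ℕ) : Type := EuclideanSpace ℝ (Fin (m + 1))

/-- The `i`-th coordinate vector. -/
def basisVec {m : ℕ} (i : Fin (m + 1)) : Coord m := EuclideanSpace.single i (1 : ℝ)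

/-- The partial derivative `∂ᵢ f` at `y`. -/
def pd {m : ℕ} (i : Fin (m + 1)) (f : Coord m → ℝ) (y : Coord m) : ℝ :=
  fderiv ℝ f y (basisVec i)

section Local

variable {m : ℕ} (G : Coord m → Matrix (Fin (m + 1)) (Fin (m + 1)) ℝ)
  (U : Coord m → Fin (m + 1) → ℝ)

/-- Christoffel symbols `Γᵏᵢⱼ = ½ gᵏˡ (∂ᵢ gⱼₗ + ∂ⱼ gᵢₗ - ∂ₗ gᵢⱼ)`. -/
def christoffel (k i j : Fin (m + 1)) (y : Coord m) : ℝ :=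
  (1 / 2) * ∑ l, (G y)⁻¹ k l *
    (pd i (fun z => G z j l) y + pd j (fun z => G z i l) y - pd l (fun z => G z i j) y)

/-- Covariant derivative of a covector field, `∇ᵢ wⱼ = ∂ᵢ wⱼ - Γᵏᵢⱼ wₖ`. -/
def covD (w : Coord m → Fin (m + 1) → ℝ) (i j : Fin (m + 1)) (y : Coord m) : ℝ :=
  pd i (fun z => w z j) y - ∑ k, christoffel G k i j y * w y k

/-- Divergence of a vector field, `∇ₚ vᵖ = ∂ₚ vᵖ + Γᵖₚₖ vᵏ`. -/
def divergence (v : Coord m → Fin (m + 1) → ℝ) (y : Coord m) : ℝ :=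
  ∑ p, (pd p (fun z => v z p) y + ∑ k, christoffel G p p k y * v y k)

/-- Lowering an index, `vᵢ = gᵢⱼ vʲ`. -/
def lower (v : Coord m → Fin (m + 1) → ℝ) (y : Coord m) (i : Fin (m + 1)) : ℝ :=
  ∑ j, G y i j * v y j

/-- Raising an index, `wⁱ = gⁱʲ wⱼ`. -/
def raise (w : Coord m → Fin (m + 1) → ℝ) (y : Coord m) (i : Fin (m + 1)) : ℝ :=
  ∑ j, (G y)⁻¹ i j * w y j

/-- Riemann tensor `Rⱼₖₗᵐ = -∂ⱼ Γᵐₖₗ + ∂ₖ Γᵐⱼₗ + Γᵖⱼₗ Γᵐₖₚ - Γᵖₖₗ Γᵐⱼₚ` (upper index `q`). -/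
def riemann (j k l q : Fin (m + 1)) (y : Coord m) : ℝ :=
  -pd j (christoffel G q k l) y + pd k (christoffel G q j l) y
    + ∑ p, christoffel G p j l y * christoffel G q k p y
    - ∑ p, christoffel G p k l y * christoffel G q j p y

/-- Ricci tensor `Rⱼₗ = Rⱼₖₗᵏ`
(so that `Rᵢⱼ = ∂ₘ Γᵐᵢⱼ - ∂ᵢ Γᵐₘⱼ + Γᵏᵢⱼ Γᵐₖₘ - Γᵏᵢₘ Γᵐₖⱼ`; round spheres have positive Ricci
curvature). -/
def ricci (j l : Fin (m + 1)) (y : Coord m) : ℝ :=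
  ∑ k, riemann G j k l k y

/-- Curvature scalar `R = gʲˡ Rⱼₗ`. -/
def scalarCurv (y : Coord m) : ℝ :=
  ∑ j, ∑ l, (G y)⁻¹ j l * ricci G j l y

/-- The derivative of a scalar along the velocity, `ḟ = uᵏ ∇ₖ f`. -/
def dotD (f : Coord m → ℝ) (y : Coord m) : ℝ :=
  ∑ k, U y k * pd k f y

/-- The acceleration covector, `u̇ⱼ = uᵏ ∇ₖ uⱼ`. -/
def accel (y : Coord m) (j : Fin (m + 1)) : ℝ :=
  ∑ k, U y k * covD G (lower G U) k j y

/-- The divergence of the acceleration, `∇ₚ u̇ᵖ`. -/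
def divAccel (y : Coord m) : ℝ :=
  divergence G (raise G (accel G U)) y

/-- The expansion parameter, `φ = ∇ⱼ uʲ / (n - 1)`. -/
def expansion (y : Coord m) : ℝ :=
  divergence G U y / (m : ℝ)

/-- The scalar `ξ = (n - 1) (φ² + φ̇)`. -/
def xi (y : Coord m) : ℝ :=
  (m : ℝ) * (expansion G U y ^ 2 + dotD U (expansion G U) y)

end Local

/-! ### Lorentzian manifolds and doubly warped spacetimes -/

section Manifold

variable {m : ℕ} (M : Type*) [TopologicalSpace M] [ChartedSpace (Coord m) M]
  [IsManifold 𝓘(ℝ, Coord m) ∞ M]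

/-- A smooth Lorentzian metric of signature `(-, +, …, +)` on the manifold `M`. -/
structure LorentzianMetric where
  /-- The scalar product on each tangent space. -/
  inner (x : M) : TangentSpace 𝓘(ℝ, Coord m) x →L[ℝ] TangentSpace 𝓘(ℝ, Coord m) x →L[ℝ] ℝ
  symm (x : M) (v w : TangentSpace 𝓘(ℝ, Coord m) x) : inner x v w = inner x w v
  /-- There is a timelike vector, whose orthogonal complement is positive definite. -/
  lorentzian (x : M) : ∃ v : TangentSpace 𝓘(ℝ, Coord m) x, inner x v v < 0 ∧
    ∀ w : TangentSpace 𝓘(ℝ, Coord m) x, inner x v w = 0 → w ≠ 0 → 0 < inner x w w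
  contMDiff : ContMDiff 𝓘(ℝ, Coord m)
    (𝓘(ℝ, Coord m).prod 𝓘(ℝ, Coord m →L[ℝ] Coord m →L[ℝ] ℝ)) ∞
    (fun x => Bundle.TotalSpace.mk' (Coord m →L[ℝ] Coord m →L[ℝ] ℝ)
      (E := fun x : M => TangentSpace 𝓘(ℝ, Coord m) x →L[ℝ]
        TangentSpace 𝓘(ℝ, Coord m) x →L[ℝ] ℝ) x (inner x))

variable {M}

/-- The coordinate vector `∂/∂yⁱ` of the chart `e` at the point of coordinates `y ∈ e.target`. -/
def coordVec (e : OpenPartialHomeomorph M (Coord m)) (y : Coord m) (i : Fin (m + 1)) :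
    TangentSpace 𝓘(ℝ, Coord m) (e.symm y) :=
  mfderiv 𝓘(ℝ, Coord m) 𝓘(ℝ, Coord m) e.symm y (basisVec i)

/-- The components `gᵢⱼ` of the metric in the chart `e`, as functions of the coordinates. -/
def metricComp (g : LorentzianMetric (m := m) M) (e : OpenPartialHomeomorph M (Coord m))
    (y : Coord m) : Matrix (Fin (m + 1)) (Fin (m + 1)) ℝ :=
  Matrix.of fun i j => g.inner (e.symm y) (coordVec e y i) (coordVec e y j)

/-- The components `uⁱ` of a vector field in the chart `e`, as functions of the coordinates. -/
def vecComp (u : (x : M) → TangentSpace 𝓘(ℝ, Coord m) x)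
    (e : OpenPartialHomeomorph M (Coord m)) (y : Coord m) (i : Fin (m + 1)) : ℝ :=
  (show Coord m from
    mfderiv 𝓘(ℝ, Coord m) 𝓘(ℝ, Coord m) e (e.symm y) (u (e.symm y))) i

/-- The space coordinates `𝐱` of a point of coordinates `(t, 𝐱)`. -/
def spatial (y : Coord m) : Fin m → ℝ := fun μ => y μ.succ

/-- The matrix of `-b² dt² + a² g⋆_{μν} dx^μ dx^ν`. -/
def warpedMatrix (a b : ℝ) (gs : Matrix (Fin m) (Fin m) ℝ) :
    Matrix (Fin (m + 1)) (Fin (m + 1)) ℝ :=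
  Matrix.of (Fin.cons (Fin.cons (-b ^ 2) (fun _ => 0))
    (fun μ => Fin.cons 0 (fun ν => a ^ 2 * gs μ ν)))

/-- The chart `e` has coordinates `(t, 𝐱)` in which the metric is
`ds² = -b²(𝐱) dt² + a²(t) g⋆_{μν}(𝐱) dx^μ dx^ν`, where `a, b > 0`, `g⋆` is a Riemannian metric, and
`u = b⁻¹ ∂/∂t` (that is `u₀ = -b`, `u_μ = 0`). All functions are smooth. -/
def IsComovingChart (g : LorentzianMetric (m := m) M)
    (u : (x : M) → TangentSpace 𝓘(ℝ, Coord m) x)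
    (e : OpenPartialHomeomorph M (Coord m)) : Prop :=
  ∃ (a : ℝ → ℝ) (b : (Fin m → ℝ) → ℝ) (gs : (Fin m → ℝ) → Matrix (Fin m) (Fin m) ℝ),
    ContDiffOn ℝ ∞ (fun y : Coord m => a (y 0)) e.target ∧
    ContDiffOn ℝ ∞ (fun y : Coord m => b (spatial y)) e.target ∧
    (∀ μ ν, ContDiffOn ℝ ∞ (fun y : Coord m => gs (spatial y) μ ν) e.target) ∧
    ∀ y ∈ e.target,
      0 < a (y 0) ∧ 0 < b (spatial y) ∧ (gs (spatial y)).PosDef ∧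
      metricComp g e y = warpedMatrix (a (y 0)) (b (spatial y)) (gs (spatial y)) ∧
      vecComp u e y = Fin.cons (b (spatial y))⁻¹ (fun _ => 0)

/-- The Lorentzian manifold `(M, g)` is doubly warped, with unit timelike velocity field `u`: every
point has coordinates in which the metric has the doubly warped form and `u = b⁻¹ ∂/∂t`. -/
def IsDoublyWarped (g : LorentzianMetric (m := m) M)
    (u : (x : M) → TangentSpace 𝓘(ℝ, Coord m) x) : Prop :=
  ∀ x : M, ∃ e ∈ IsManifold.maximalAtlas 𝓘(ℝ, Coord m) ∞ M,
    x ∈ e.source ∧ IsComovingChart g u e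

end Manifold

end DoublyWarped

end

/-! The identities are tensorial, so it suffices to check them in a comoving chart around the point.
Covariance is proved rather than assumed, because the statement is written with explicit components.

Covariance rests on the law `J Γ'ᵢ = Aᵢ J + ∂ᵢJ` (`jac_mul_conn`). Here `J` is the Jacobian of the
coordinate change and `Aᵢ` is the pulled-back connection matrix. The law follows from uniqueness of
the torsion free metric connection (`conn_eq_of_compatible`). Differentiating it makes the curvature
transform by conjugation (`jac_mul_curv`). Hence `φ`, `ξ`, `∇ₚu̇ᵖ` and `R` are scalars, and `u` and
`u̇` transform with lower indices as covectors.

In a comoving chart write `α(t)` for the scale factor, `β(𝐱)` for the lapse, `′` for `∂ₜ`, and `m =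
n - 1`. Then `φ = α′/(αβ)`, `ξ = m α″/(αβ²)`, `u̇₀ = 0` and `u̇_μ = ∂_μβ/β`. The first identity
holds because `ξβ²` depends on time only. The second holds because `α² ∇ₚu̇ᵖ` is stationary. For the
third, `scalarCurv_warpedMetric` gives `R = S(𝐱)/α² + 2ξ + m(m-1)φ²`. So `R - 2ξ - m(m-1)φ²` decays
at the rate `-2φ`, and `φ̇ = ξ/m - φ²` turns this into the claim.

The stationary functions, such as `S`, are never evaluated. Only their independence of time matters,
and this is tracked by `Indep`. -/

noncomputable section

namespace DoublyWarped

/-! ### Partial derivatives and Jacobians on coordinate space -/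

section PartialDerivatives

variable {m : ℕ} {V W : Set (Coord m)} {f g h : Coord m → ℝ} {y : Coord m}

theorem differentiableAt_of_smoothOn (hV : IsOpen V) (hf : ContDiffOn ℝ ∞ f V) (hy : y ∈ V) :
    DifferentiableAt ℝ f y :=
  (hf.contDiffAt (hV.mem_nhds hy)).differentiableAt (by simp)

theorem pd_congr_of_eventuallyEq (h : f =ᶠ[nhds y] g) (i : Fin (m + 1)) : pd i f y = pd i g y := by
  unfold pd; rw [h.fderiv_eq]

theorem pd_congr (hV : IsOpen V) (h : ∀ z ∈ V, f z = g z) (hy : y ∈ V) (i : Fin (m + 1)) :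
    pd i f y = pd i g y :=
  pd_congr_of_eventuallyEq (Filter.eventuallyEq_of_mem (hV.mem_nhds hy) h) i

theorem pd_add (hf : DifferentiableAt ℝ f y) (hg : DifferentiableAt ℝ g y) (i : Fin (m + 1)) :
    pd i (fun z => f z + g z) y = pd i f y + pd i g y := by
  unfold pd; rw [fderiv_fun_add hf hg]; rfl

theorem pd_mul (hf : DifferentiableAt ℝ f y) (hg : DifferentiableAt ℝ g y) (i : Fin (m + 1)) :
    pd i (fun z => f z * g z) y = pd i f y * g y + f y * pd i g y := by
  unfold pd; rw [fderiv_fun_mul hf hg]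
  simp only [add_apply, smul_apply, smul_eq_mul]
  ring

theorem pd_sum {ι : Type*} [Fintype ι] {F : ι → Coord m → ℝ}
    (hF : ∀ k, DifferentiableAt ℝ (F k) y) (i : Fin (m + 1)) :
    pd i (fun z => ∑ k, F k z) y = ∑ k, pd i (F k) y := by
  unfold pd; rw [fderiv_fun_sum (fun k _ => hF k)]; simp

theorem pd_const (c : ℝ) (i : Fin (m + 1)) : pd i (fun _ => c) y = 0 := by
  unfold pd; simp

theorem smoothOn_pd (hV : IsOpen V) (hf : ContDiffOn ℝ ∞ f V) (i : Fin (m + 1)) :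
    ContDiffOn ℝ ∞ (pd i f) V := by
  unfold pd
  exact (hf.fderiv_of_isOpen hV (by simp)).clm_apply contDiffOn_const

theorem pd_comm (hV : IsOpen V) (hf : ContDiffOn ℝ ∞ f V) (hy : y ∈ V) (i j : Fin (m + 1)) :
    pd i (pd j f) y = pd j (pd i f) y := by
  have hc := hf.contDiffAt (hV.mem_nhds hy)
  have hd : DifferentiableAt ℝ (fderiv ℝ f) y :=
    ((hf.fderiv_of_isOpen (m := ∞) hV (by simp)).contDiffAt (hV.mem_nhds hy)).differentiableAt
      (by simp)
  have key : ∀ v w : Coord m,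
      fderiv ℝ (fun z => fderiv ℝ f z w) y v = fderiv ℝ (fderiv ℝ f) y v w := by
    intro v w
    rw [fderiv_clm_apply hd (differentiableAt_const _)]
    simp
  have hs : IsSymmSndFDerivAt ℝ f y := hc.isSymmSndFDerivAt (by simp; exact WithTop.coe_le_coe.2 (le_top (a := (2 : ℕ∞))))
  unfold pd
  rw [key, key]
  exact hs _ _

/-- The Jacobian matrix `∂fᵃ/∂yⁱ`. -/
def jac (F : Coord m → Coord m) (y : Coord m) : Matrix (Fin (m + 1)) (Fin (m + 1)) ℝ :=
  Matrix.of fun a i => pd i (fun z => F z a) y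

theorem differentiableAt_coord {F : Coord m → Coord m} (hF : DifferentiableAt ℝ F y)
    (a : Fin (m + 1)) : DifferentiableAt ℝ (fun z => F z a) y :=
  (EuclideanSpace.proj a : Coord m →L[ℝ] ℝ).differentiableAt.comp y hF

theorem jac_eq {F : Coord m → Coord m} (hF : DifferentiableAt ℝ F y) (a i : Fin (m + 1)) :
    jac F y a i = fderiv ℝ F y (basisVec i) a := by
  have h := ((EuclideanSpace.proj a : Coord m →L[ℝ] ℝ).hasFDerivAt.comp y
    hF.hasFDerivAt).fderiv
  change fderiv ℝ (fun z => F z a) y = _ at h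
  simp only [jac, Matrix.of_apply, pd, h]
  rfl

theorem sum_smul_basisVec (v : Coord m) : ∑ a, v a • basisVec a = v := by
  ext j
  simp [basisVec, Finset.sum_apply, Pi.single_apply]

theorem pd_comp {F : Coord m → Coord m} (hF : DifferentiableAt ℝ F y)
    (hh : DifferentiableAt ℝ h (F y)) (i : Fin (m + 1)) :
    pd i (fun z => h (F z)) y = ∑ a, pd a h (F y) * jac F y a i := by
  unfold pd
  change fderiv ℝ (h ∘ F) y _ = _
  rw [fderiv_comp y hh hF, ContinuousLinearMap.comp_apply,
    ← sum_smul_basisVec (fderiv ℝ F y (basisVec i)), map_sum]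
  refine Finset.sum_congr rfl fun a _ => ?_
  rw [map_smul, jac_eq hF, smul_eq_mul, mul_comm]

theorem smoothOn_coord {F : Coord m → Coord m} (hF : ContDiffOn ℝ ∞ F V) (a : Fin (m + 1)) :
    ContDiffOn ℝ ∞ (fun z => F z a) V :=
  (EuclideanSpace.proj a : Coord m →L[ℝ] ℝ).contDiff.comp_contDiffOn hF

theorem smoothOn_jac {F : Coord m → Coord m} (hV : IsOpen V) (hF : ContDiffOn ℝ ∞ F V)
    (a i : Fin (m + 1)) : ContDiffOn ℝ ∞ (fun z => jac F z a i) V :=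
  smoothOn_pd hV (smoothOn_coord hF a) i

theorem pd_jac_comm {F : Coord m → Coord m} (hV : IsOpen V) (hF : ContDiffOn ℝ ∞ F V)
    (hy : y ∈ V) (a i j : Fin (m + 1)) :
    pd i (fun z => jac F z a j) y = pd j (fun z => jac F z a i) y :=
  pd_comm hV (smoothOn_coord hF a) hy i j

end PartialDerivatives

/-! ### Entrywise calculus of matrix valued functions -/

section MatrixFunctions

variable {m : ℕ} {V W : Set (Coord m)} {y : Coord m}

/-- Entrywise smoothness of a matrix valued function. -/
def MSmooth {p q : Type*} (A : Coord m → Matrix p q ℝ) (V : Set (Coord m)) : Prop :=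
  ∀ i j, ContDiffOn ℝ ∞ (fun z => A z i j) V

/-- Entrywise partial derivative of a matrix valued function. -/
def mpd {p q : Type*} (i : Fin (m + 1)) (A : Coord m → Matrix p q ℝ) (y : Coord m) :
    Matrix p q ℝ :=
  Matrix.of fun k l => pd i (fun z => A z k l) y

variable {p q r : Type*} {A A' : Coord m → Matrix p q ℝ} {B : Coord m → Matrix q r ℝ}

theorem MSmooth.transpose (hA : MSmooth A V) : MSmooth (fun z => (A z).transpose) V :=
  fun i j => hA j i

theorem MSmooth.mul [Fintype q] (hA : MSmooth A V) (hB : MSmooth B V) :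
    MSmooth (fun z => A z * B z) V := by
  intro i j
  simp only [Matrix.mul_apply]
  exact ContDiffOn.sum fun k _ => (hA i k).mul (hB k j)

theorem MSmooth.congr (hA : MSmooth A V) (h : ∀ z ∈ V, A' z = A z) : MSmooth A' V :=
  fun i j => (hA i j).congr fun z hz => by rw [h z hz]

theorem MSmooth.mpd (hV : IsOpen V) (hA : MSmooth A V) (i : Fin (m + 1)) : MSmooth (mpd i A) V :=
  fun k l => smoothOn_pd hV (hA k l) i

theorem MSmooth.det [Fintype p] [DecidableEq p] {A : Coord m → Matrix p p ℝ} (hA : MSmooth A V) :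
    ContDiffOn ℝ ∞ (fun z => (A z).det) V := by
  simp only [Matrix.det_apply']
  exact ContDiffOn.sum fun σ _ => contDiffOn_const.mul (contDiffOn_prod fun k _ => hA _ _)

/-- By Cramer's rule each entry of the inverse is a quotient of determinants, hence smooth where the
denominator does not vanish. -/
theorem MSmooth.inv [Fintype p] [DecidableEq p] {A : Coord m → Matrix p p ℝ} (hA : MSmooth A V)
    (hdet : ∀ z ∈ V, (A z).det ≠ 0) : MSmooth (fun z => (A z)⁻¹) V := by
  intro i j
  have h : ∀ z, (A z)⁻¹ i j = (A z).det⁻¹ * ((A z).updateRow j (Pi.single i 1)).det := by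
    intro z
    rw [Matrix.inv_def, Matrix.smul_apply, Ring.inverse_eq_inv', Matrix.adjugate_apply, smul_eq_mul]
  simp only [h]
  refine (hA.det.inv hdet).mul (MSmooth.det fun k l => ?_)
  by_cases hk : k = j
  · subst hk; simp only [Matrix.updateRow_self]; exact contDiffOn_const
  · simp only [Matrix.updateRow_ne hk]; exact hA k l

theorem mpd_mul [Fintype q] (hV : IsOpen V) (hA : MSmooth A V) (hB : MSmooth B V) (hy : y ∈ V)
    (i : Fin (m + 1)) :
    mpd i (fun z => A z * B z) y = mpd i A y * B y + A y * mpd i B y := by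
  ext k l
  simp only [mpd, Matrix.of_apply, Matrix.mul_apply, Matrix.add_apply]
  have hA' := fun a => differentiableAt_of_smoothOn hV (hA k a) hy
  have hB' := fun a => differentiableAt_of_smoothOn hV (hB a l) hy
  rw [pd_sum (fun a => (hA' a).fun_mul (hB' a)), ← Finset.sum_add_distrib]
  exact Finset.sum_congr rfl fun a _ => pd_mul (hA' a) (hB' a) i

theorem mpd_add (hV : IsOpen V) (hA : MSmooth A V) (hA' : MSmooth A' V) (hy : y ∈ V)
    (i : Fin (m + 1)) :
    mpd i (fun z => A z + A' z) y = mpd i A y + mpd i A' y := by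
  ext k l
  exact pd_add (differentiableAt_of_smoothOn hV (hA k l) hy)
    (differentiableAt_of_smoothOn hV (hA' k l) hy) i

theorem mpd_sum {ι : Type*} [Fintype ι] {F : ι → Coord m → Matrix p q ℝ} (hV : IsOpen V)
    (hF : ∀ a, MSmooth (F a) V) (hy : y ∈ V) (i : Fin (m + 1)) :
    mpd i (fun z => ∑ a, F a z) y = ∑ a, mpd i (F a) y := by
  ext k l
  simp only [mpd, Matrix.of_apply, Matrix.sum_apply]
  exact pd_sum (fun a => differentiableAt_of_smoothOn hV (hF a k l) hy) i

theorem mpd_smul {c : Coord m → ℝ} (hV : IsOpen V) (hc : ContDiffOn ℝ ∞ c V) (hA : MSmooth A V)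
    (hy : y ∈ V) (i : Fin (m + 1)) :
    mpd i (fun z => c z • A z) y = pd i c y • A y + c y • mpd i A y := by
  ext k l
  exact pd_mul (differentiableAt_of_smoothOn hV hc hy)
    (differentiableAt_of_smoothOn hV (hA k l) hy) i

theorem mpd_congr (hV : IsOpen V) (h : ∀ z ∈ V, A z = A' z) (hy : y ∈ V) (i : Fin (m + 1)) :
    mpd i A y = mpd i A' y := by
  ext k l
  exact pd_congr hV (fun z hz => by rw [h z hz]) hy i

theorem mpd_comm (hV : IsOpen V) (hA : MSmooth A V) (hy : y ∈ V) (i j : Fin (m + 1)) :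
    mpd i (mpd j A) y = mpd j (mpd i A) y := by
  ext k l
  exact pd_comm hV (hA k l) hy i j

theorem mpd_transpose (i : Fin (m + 1)) :
    mpd i (fun z => (A z).transpose) y = (mpd i A y).transpose := rfl

theorem mpd_comp {F : Coord m → Coord m} (hV : IsOpen V) (hW : IsOpen W)
    (hF : ContDiffOn ℝ ∞ F V) (hFW : Set.MapsTo F V W) (hA : MSmooth A W) (hy : y ∈ V)
    (i : Fin (m + 1)) :
    mpd i (fun z => A (F z)) y = ∑ a, jac F y a i • mpd a A (F y) := by
  ext k l
  simp only [mpd, Matrix.of_apply, Matrix.sum_apply, Matrix.smul_apply, smul_eq_mul]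
  rw [pd_comp (h := fun z => A z k l)
    ((hF.contDiffAt (hV.mem_nhds hy)).differentiableAt (by simp))
    (differentiableAt_of_smoothOn hW (hA k l) (hFW hy))]
  exact Finset.sum_congr rfl fun a _ => mul_comm _ _

theorem MSmooth.comp {F : Coord m → Coord m} (hF : ContDiffOn ℝ ∞ F V) (hFW : Set.MapsTo F V W)
    (hA : MSmooth A W) : MSmooth (fun z => A (F z)) V :=
  fun i j => (hA i j).comp hF hFW

theorem MSmooth.smul {c : Coord m → ℝ} (hc : ContDiffOn ℝ ∞ c V) (hA : MSmooth A V) :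
    MSmooth (fun z => c z • A z) V :=
  fun i j => hc.mul (hA i j)

theorem MSmooth.sum {ι : Type*} [Fintype ι] {F : ι → Coord m → Matrix p q ℝ}
    (hF : ∀ a, MSmooth (F a) V) : MSmooth (fun z => ∑ a, F a z) V := by
  intro i j
  simp only [Matrix.sum_apply]
  exact ContDiffOn.sum fun a _ => hF a i j

theorem mSmooth_jac {F : Coord m → Coord m} (hV : IsOpen V) (hF : ContDiffOn ℝ ∞ F V) :
    MSmooth (jac F) V :=
  fun a i => smoothOn_jac hV hF a i

end MatrixFunctions

/-! ### The Levi-Civita connection as a family of matrices -/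

section Connection

variable {m : ℕ} {V W : Set (Coord m)} {y : Coord m}
  {G : Coord m → Matrix (Fin (m + 1)) (Fin (m + 1)) ℝ}

/-- The connection matrix `(Γᵢ)ᵏⱼ = Γᵏᵢⱼ`. -/
def conn (G : Coord m → Matrix (Fin (m + 1)) (Fin (m + 1)) ℝ) (i : Fin (m + 1)) (y : Coord m) :
    Matrix (Fin (m + 1)) (Fin (m + 1)) ℝ :=
  Matrix.of fun k j => christoffel G k i j y

/-- A torsion free metric connection has the Christoffel symbols as its coefficients. -/
theorem conn_eq_of_compatible (hdet : (G y).det ≠ 0) (hsymm : (G y).IsSymm)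
    {C : Fin (m + 1) → Matrix (Fin (m + 1)) (Fin (m + 1)) ℝ}
    (htors : ∀ i j k, C i k j = C j k i)
    (hcompat : ∀ i, mpd i G y = (C i).transpose * G y + G y * C i) (i : Fin (m + 1)) :
    conn G i y = C i := by
  -- `G Cᵢ` is the connection with its upper index lowered; vanishing torsion makes it symmetric in
  -- the other two indices.
  have hsym : ∀ i j l, (G y * C i) l j = (G y * C j) l i := fun i j l => by
    simp only [Matrix.mul_apply, htors i j]
  have hpd : ∀ i j l, pd i (fun z => G z j l) y = (G y * C i) j l + (G y * C i) l j := by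
    intro i j l
    have h := congrFun (congrFun (hcompat i) j) l
    have h2 : ((C i).transpose * G y) = (G y * C i).transpose := by
      rw [Matrix.transpose_mul, hsymm.eq]
    rw [h2] at h
    simp only [mpd, Matrix.of_apply, Matrix.add_apply, Matrix.transpose_apply] at h
    linarith
  ext k j
  -- Koszul's argument: compatibility gives six terms for the three derivatives; by the symmetry
  -- four of them cancel and two coincide.
  have h1 : ∀ l, (G y)⁻¹ k l * (pd i (fun z => G z j l) y + pd j (fun z => G z i l) y
      - pd l (fun z => G z i j) y) = 2 * ((G y)⁻¹ k l * (G y * C i) l j) := by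
    intro l
    rw [hpd, hpd, hpd, hsym j i l, hsym i l j, hsym j l i]
    ring
  simp only [conn, Matrix.of_apply, christoffel, h1, ← Finset.mul_sum]
  rw [← Matrix.mul_apply, ← Matrix.mul_assoc, Matrix.nonsing_inv_mul _ (Ne.isUnit hdet),
    Matrix.one_mul]
  ring

theorem christoffel_symm (hV : IsOpen V) (hsymm : ∀ z ∈ V, (G z).IsSymm) (hy : y ∈ V)
    (k i j : Fin (m + 1)) : christoffel G k i j y = christoffel G k j i y := by
  unfold christoffel
  congr 1
  refine Finset.sum_congr rfl fun l _ => ?_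
  rw [pd_congr hV (f := fun z => G z i j) (g := fun z => G z j i)
    (fun z hz => (hsymm z hz).apply j i) hy]
  ring

/-- This is `∇g = 0` in matrix form. After lowering the index of the Christoffel symbols, adding the
transpose cancels the two derivatives that are antisymmetric under the exchange and doubles the
remaining one. -/
theorem conn_compatible (hV : IsOpen V) (hdet : (G y).det ≠ 0) (hsymm : ∀ z ∈ V, (G z).IsSymm)
    (hy : y ∈ V) (i : Fin (m + 1)) :
    mpd i G y = (conn G i y).transpose * G y + G y * conn G i y := by
  have hlow : ∀ l j, (G y * conn G i y) l j = (1 / 2) * (pd i (fun z => G z j l) y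
      + pd j (fun z => G z i l) y - pd l (fun z => G z i j) y) := by
    intro l j
    have : conn G i y = (G y)⁻¹ * Matrix.of fun l j => (1 / 2) * (pd i (fun z => G z j l) y
      + pd j (fun z => G z i l) y - pd l (fun z => G z i j) y) := by
      ext k j
      simp only [conn, Matrix.of_apply, christoffel, Matrix.mul_apply, Finset.mul_sum]
      exact Finset.sum_congr rfl fun l _ => by ring
    rw [this, ← Matrix.mul_assoc, Matrix.mul_nonsing_inv _ (Ne.isUnit hdet), Matrix.one_mul]
    rfl
  have h2 : (conn G i y).transpose * G y = (G y * conn G i y).transpose := by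
    rw [Matrix.transpose_mul, (hsymm y hy).eq]
  ext j l
  have hs : ∀ a b c, pd a (fun z => G z b c) y = pd a (fun z => G z c b) y := fun a b c =>
    pd_congr hV (fun z hz => (hsymm z hz).apply c b) hy a
  rw [h2, Matrix.add_apply, Matrix.transpose_apply, hlow, hlow, hs i l j]
  simp only [mpd, Matrix.of_apply]
  ring

theorem smoothOn_christoffel (hV : IsOpen V) (hG : MSmooth G V) (hdet : ∀ z ∈ V, (G z).det ≠ 0)
    (k i j : Fin (m + 1)) : ContDiffOn ℝ ∞ (christoffel G k i j) V := by
  unfold christoffel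
  refine contDiffOn_const.mul (ContDiffOn.sum fun l _ => (hG.inv hdet k l).mul ?_)
  exact ((smoothOn_pd hV (hG j l) i).add (smoothOn_pd hV (hG i l) j)).sub
    (smoothOn_pd hV (hG i j) l)

theorem mSmooth_conn (hV : IsOpen V) (hG : MSmooth G V) (hdet : ∀ z ∈ V, (G z).det ≠ 0)
    (i : Fin (m + 1)) : MSmooth (conn G i) V :=
  fun k j => smoothOn_christoffel hV hG hdet k i j

end Connection

/-! ### Change of coordinates for the connection -/

/-- `F` maps the open set `V` smoothly into the open set `W`, and the metric `G'` on `V` is the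
pullback along `F` of the metric `G` on `W`. -/
structure IsPullback {m : ℕ} (F : Coord m → Coord m) (V W : Set (Coord m))
    (G' G : Coord m → Matrix (Fin (m + 1)) (Fin (m + 1)) ℝ) : Prop where
  isOpen_left : IsOpen V
  isOpen_right : IsOpen W
  smooth : ContDiffOn ℝ ∞ F V
  mapsTo : Set.MapsTo F V W
  det_jac : ∀ z ∈ V, (jac F z).det ≠ 0
  metric_smooth : MSmooth G W
  metric_symm : ∀ z ∈ W, (G z).IsSymm
  metric_det : ∀ z ∈ W, (G z).det ≠ 0
  metric_eq : ∀ z ∈ V, G' z = (jac F z).transpose * G (F z) * jac F z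

namespace IsPullback

variable {m : ℕ} {V W : Set (Coord m)} {y : Coord m} {F : Coord m → Coord m}
  {G' G : Coord m → Matrix (Fin (m + 1)) (Fin (m + 1)) ℝ}
  {U' U : Coord m → Fin (m + 1) → ℝ}

/-- The pullback of the connection matrices, before the change of basis. -/
def pullConn (F : Coord m → Coord m) (G : Coord m → Matrix (Fin (m + 1)) (Fin (m + 1)) ℝ)
    (i : Fin (m + 1)) (z : Coord m) : Matrix (Fin (m + 1)) (Fin (m + 1)) ℝ :=
  ∑ a, jac F z a i • conn G a (F z)

theorem mSmooth_left (h : IsPullback F V W G' G) : MSmooth G' V :=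
  (((mSmooth_jac h.isOpen_left h.smooth).transpose.mul
    (h.metric_smooth.comp h.smooth h.mapsTo)).mul (mSmooth_jac h.isOpen_left h.smooth)).congr
    h.metric_eq

theorem det_left (h : IsPullback F V W G' G) : ∀ z ∈ V, (G' z).det ≠ 0 := by
  intro z hz
  rw [h.metric_eq z hz, Matrix.det_mul, Matrix.det_mul, Matrix.det_transpose]
  exact mul_ne_zero (mul_ne_zero (h.det_jac z hz) (h.metric_det _ (h.mapsTo hz))) (h.det_jac z hz)

theorem symm_left (h : IsPullback F V W G' G) : ∀ z ∈ V, (G' z).IsSymm := by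
  intro z hz
  rw [Matrix.IsSymm, h.metric_eq z hz, Matrix.transpose_mul, Matrix.transpose_mul,
    Matrix.transpose_transpose, (h.metric_symm _ (h.mapsTo hz)).eq, Matrix.mul_assoc]

theorem mSmooth_pullConn (h : IsPullback F V W G' G) (i : Fin (m + 1)) :
    MSmooth (pullConn F G i) V :=
  MSmooth.sum fun a => MSmooth.smul (smoothOn_jac h.isOpen_left h.smooth a i)
    ((mSmooth_conn h.isOpen_right h.metric_smooth h.metric_det a).comp h.smooth h.mapsTo)

/-- The transformation law of the Christoffel symbols. -/
theorem jac_mul_conn (h : IsPullback F V W G' G) (hy : y ∈ V) (i : Fin (m + 1)) :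
    jac F y * conn G' i y = pullConn F G i y * jac F y + mpd i (jac F) y := by
  have hJ := mSmooth_jac h.isOpen_left h.smooth
  have hGF := h.metric_smooth.comp h.smooth h.mapsTo
  have hu : IsUnit (jac F y).det := (h.det_jac y hy).isUnit
  have hFy := h.mapsTo hy
  -- Solving the law for `Γ'ᵢ` gives the candidate; by uniqueness it only has to be torsion free and
  -- compatible with `G'`.
  have hC : conn G' i y = (jac F y)⁻¹ * (pullConn F G i y * jac F y + mpd i (jac F) y) := by
    refine conn_eq_of_compatible
      (C := fun i => (jac F y)⁻¹ * (pullConn F G i y * jac F y + mpd i (jac F) y))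
      (h.det_left y hy) (h.symm_left y hy) ?_ ?_ i
    -- Torsion: `∂J` is symmetric because second derivatives of `F` commute, and the other term
    -- because the Christoffel symbols of `G` are symmetric.
    · intro i j k
      rw [Matrix.mul_apply, Matrix.mul_apply]
      refine Finset.sum_congr rfl fun c _ => ?_
      congr 1
      simp only [Matrix.add_apply, Matrix.mul_apply, pullConn, Matrix.sum_apply, Matrix.smul_apply,
        smul_eq_mul, mpd, Matrix.of_apply]
      rw [pd_jac_comm h.isOpen_left h.smooth hy c i j]
      congr 1
      simp only [Finset.sum_mul]
      rw [Finset.sum_comm]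
      refine Finset.sum_congr rfl fun a _ => Finset.sum_congr rfl fun b _ => ?_
      simp only [conn, Matrix.of_apply]
      rw [christoffel_symm h.isOpen_right h.metric_symm hFy c a b]
      ring
    -- Compatibility: the product rule on `Jᵀ (G ∘ F) J`, with compatibility of `G` giving the
    -- derivative of the middle factor.
    · intro i
      have h1 : mpd i G' y = mpd i (fun z => (jac F z).transpose * G (F z) * jac F z) y :=
        mpd_congr h.isOpen_left h.metric_eq hy i
      have h2 : mpd i (fun z => G (F z)) y
          = (pullConn F G i y).transpose * G (F y) + G (F y) * pullConn F G i y := by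
        rw [mpd_comp h.isOpen_left h.isOpen_right h.smooth h.mapsTo h.metric_smooth hy]
        simp only [pullConn, Matrix.transpose_sum, Finset.sum_mul, Finset.mul_sum,
          ← Finset.sum_add_distrib]
        refine Finset.sum_congr rfl fun a _ => ?_
        rw [conn_compatible h.isOpen_right (h.metric_det _ hFy) h.metric_symm hFy,
          Matrix.transpose_smul, Matrix.smul_mul, Matrix.mul_smul, smul_add]
      rw [h1, mpd_mul h.isOpen_left (hJ.transpose.mul hGF) hJ hy,
        mpd_mul h.isOpen_left hJ.transpose hGF hy, mpd_transpose, h2, h.metric_eq y hy,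
        Matrix.transpose_mul, Matrix.transpose_add, Matrix.transpose_mul]
      have e1 : (jac F y).transpose * G (F y) * jac F y *
          ((jac F y)⁻¹ * (pullConn F G i y * jac F y + mpd i (jac F) y))
          = (jac F y).transpose * G (F y) * (pullConn F G i y * jac F y + mpd i (jac F) y) := by
        rw [Matrix.mul_assoc _ (jac F y), ← Matrix.mul_assoc (jac F y),
          Matrix.mul_nonsing_inv _ hu, Matrix.one_mul]
      have e2 : (jac F y)⁻¹.transpose * ((jac F y).transpose * G (F y) * jac F y)
          = G (F y) * jac F y := by
        rw [← Matrix.mul_assoc, ← Matrix.mul_assoc, ← Matrix.transpose_mul,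
          Matrix.mul_nonsing_inv _ hu, Matrix.transpose_one, Matrix.one_mul]
      rw [e1, Matrix.mul_assoc _ (jac F y)⁻¹.transpose, e2]
      noncomm_ring
  rw [hC, ← Matrix.mul_assoc, Matrix.mul_nonsing_inv _ hu, Matrix.one_mul]

end IsPullback

theorem sum_reverse {ι κ μ : Type*} [Fintype ι] [Fintype κ] [Fintype μ] (f : ι → κ → μ → ℝ) :
    ∑ i, ∑ k, ∑ l, f i k l = ∑ l, ∑ k, ∑ i, f i k l := by
  calc ∑ i, ∑ k, ∑ l, f i k l = ∑ i, ∑ l, ∑ k, f i k l :=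
        Finset.sum_congr rfl fun _ _ => Finset.sum_comm
    _ = ∑ l, ∑ i, ∑ k, f i k l := Finset.sum_comm
    _ = ∑ l, ∑ k, ∑ i, f i k l := Finset.sum_congr rfl fun _ _ => Finset.sum_comm

/-! ### Matrix forms and smoothness of the tensor fields -/

section Tensors

variable {m : ℕ} {V : Set (Coord m)} {G : Coord m → Matrix (Fin (m + 1)) (Fin (m + 1)) ℝ}
  {U v w : Coord m → Fin (m + 1) → ℝ}

/-- A vector valued function as a one column matrix. -/
def col (v : Coord m → Fin (m + 1) → ℝ) (y : Coord m) : Matrix (Fin (m + 1)) Unit ℝ :=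
  Matrix.of fun i _ => v y i

/-- The covariant derivative `∇ᵢ v` of a vector field. -/
def covVec (G : Coord m → Matrix (Fin (m + 1)) (Fin (m + 1)) ℝ) (v : Coord m → Fin (m + 1) → ℝ)
    (i : Fin (m + 1)) (y : Coord m) : Matrix (Fin (m + 1)) Unit ℝ :=
  mpd i (col v) y + conn G i y * col v y

/-- The trace form reduces invariance of the divergence to invariance of the trace under
conjugation. -/
theorem divergence_eq_trace (y : Coord m) :
    divergence G v y = (Matrix.of fun p i => covVec G v i y p () :
      Matrix (Fin (m + 1)) (Fin (m + 1)) ℝ).trace := rfl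

theorem covD_eq (i j : Fin (m + 1)) (y : Coord m) :
    covD G w i j y = (mpd i (col w) y - (conn G i y).transpose * col w y) j () := rfl

/-- The curvature endomorphisms `(Rⱼₖ)^q_l`. -/
def curv (G : Coord m → Matrix (Fin (m + 1)) (Fin (m + 1)) ℝ) (j k : Fin (m + 1)) (y : Coord m) :
    Matrix (Fin (m + 1)) (Fin (m + 1)) ℝ :=
  mpd k (conn G j) y - mpd j (conn G k) y + conn G k y * conn G j y - conn G j y * conn G k y

/-- With the endomorphism indices absorbed into matrix products, the curvature becomes a derivative
term plus a commutator of connection matrices, to which the connection law applies directly. -/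
theorem riemann_eq_curv (j k l q : Fin (m + 1)) (y : Coord m) :
    riemann G j k l q y = curv G j k y q l := by
  simp only [riemann, curv, Matrix.sub_apply, Matrix.add_apply, Matrix.mul_apply, mpd, conn,
    Matrix.of_apply]
  rw [Finset.sum_congr rfl fun p _ =>
      mul_comm (christoffel G p j l y) (christoffel G q k p y),
    Finset.sum_congr rfl fun p _ =>
      mul_comm (christoffel G p k l y) (christoffel G q j p y)]
  ring

theorem scalarCurv_eq_trace (y : Coord m) :
    scalarCurv G y = ((G y)⁻¹ * (Matrix.of fun j l => ricci G j l y).transpose).trace := by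
  simp only [scalarCurv, Matrix.trace, Matrix.diag, Matrix.mul_apply, Matrix.transpose_apply,
    Matrix.of_apply]

theorem smoothOn_covD (hV : IsOpen V) (hG : MSmooth G V) (hdet : ∀ z ∈ V, (G z).det ≠ 0)
    (hw : ∀ i, ContDiffOn ℝ ∞ (fun z => w z i) V) (i j : Fin (m + 1)) :
    ContDiffOn ℝ ∞ (covD G w i j) V :=
  (smoothOn_pd hV (hw j) i).sub (ContDiffOn.sum fun k _ =>
    (smoothOn_christoffel hV hG hdet k i j).mul (hw k))

theorem smoothOn_lower (hG : MSmooth G V) (hv : ∀ i, ContDiffOn ℝ ∞ (fun z => v z i) V)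
    (i : Fin (m + 1)) : ContDiffOn ℝ ∞ (fun z => lower G v z i) V :=
  ContDiffOn.sum fun j _ => (hG i j).mul (hv j)

theorem smoothOn_raise (hG : MSmooth G V) (hdet : ∀ z ∈ V, (G z).det ≠ 0)
    (hw : ∀ i, ContDiffOn ℝ ∞ (fun z => w z i) V) (i : Fin (m + 1)) :
    ContDiffOn ℝ ∞ (fun z => raise G w z i) V :=
  ContDiffOn.sum fun j _ => (hG.inv hdet i j).mul (hw j)

theorem smoothOn_accel (hV : IsOpen V) (hG : MSmooth G V) (hdet : ∀ z ∈ V, (G z).det ≠ 0)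
    (hU : ∀ i, ContDiffOn ℝ ∞ (fun z => U z i) V) (j : Fin (m + 1)) :
    ContDiffOn ℝ ∞ (fun z => accel G U z j) V :=
  ContDiffOn.sum fun k _ => (hU k).mul
    (smoothOn_covD hV hG hdet (smoothOn_lower hG hU) k j)

theorem smoothOn_divergence (hV : IsOpen V) (hG : MSmooth G V) (hdet : ∀ z ∈ V, (G z).det ≠ 0)
    (hv : ∀ i, ContDiffOn ℝ ∞ (fun z => v z i) V) : ContDiffOn ℝ ∞ (divergence G v) V :=
  ContDiffOn.sum fun p _ => (smoothOn_pd hV (hv p) p).add (ContDiffOn.sum fun k _ =>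
    (smoothOn_christoffel hV hG hdet p p k).mul (hv k))

theorem smoothOn_divAccel (hV : IsOpen V) (hG : MSmooth G V) (hdet : ∀ z ∈ V, (G z).det ≠ 0)
    (hU : ∀ i, ContDiffOn ℝ ∞ (fun z => U z i) V) : ContDiffOn ℝ ∞ (divAccel G U) V :=
  smoothOn_divergence hV hG hdet (smoothOn_raise hG hdet (smoothOn_accel hV hG hdet hU))

theorem smoothOn_expansion (hV : IsOpen V) (hG : MSmooth G V) (hdet : ∀ z ∈ V, (G z).det ≠ 0)
    (hU : ∀ i, ContDiffOn ℝ ∞ (fun z => U z i) V) : ContDiffOn ℝ ∞ (expansion G U) V :=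
  (smoothOn_divergence hV hG hdet hU).div_const _

theorem smoothOn_dotD (hV : IsOpen V) (hU : ∀ i, ContDiffOn ℝ ∞ (fun z => U z i) V)
    {h : Coord m → ℝ} (hh : ContDiffOn ℝ ∞ h V) : ContDiffOn ℝ ∞ (dotD U h) V :=
  ContDiffOn.sum fun k _ => (hU k).mul (smoothOn_pd hV hh k)

theorem smoothOn_xi (hV : IsOpen V) (hG : MSmooth G V) (hdet : ∀ z ∈ V, (G z).det ≠ 0)
    (hU : ∀ i, ContDiffOn ℝ ∞ (fun z => U z i) V) : ContDiffOn ℝ ∞ (xi G U) V :=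
  contDiffOn_const.mul (((smoothOn_expansion hV hG hdet hU).pow 2).add
    (smoothOn_dotD hV hU (smoothOn_expansion hV hG hdet hU)))

theorem smoothOn_scalarCurv (hV : IsOpen V) (hG : MSmooth G V) (hdet : ∀ z ∈ V, (G z).det ≠ 0) :
    ContDiffOn ℝ ∞ (scalarCurv G) V := by
  refine ContDiffOn.sum fun j _ => ContDiffOn.sum fun l _ => (hG.inv hdet j l).mul
    (ContDiffOn.sum fun k _ => ?_)
  have hΓ := fun k i j => smoothOn_christoffel hV hG hdet k i j
  exact (((smoothOn_pd hV (hΓ k k l) j).neg.add (smoothOn_pd hV (hΓ k j l) k)).add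
    (ContDiffOn.sum fun p _ => (hΓ p j l).mul (hΓ k k p))).sub
    (ContDiffOn.sum fun p _ => (hΓ p k l).mul (hΓ k j p))

end Tensors

/-! ### Covariance of tensors and invariance of scalars -/

namespace IsPullback

variable {m : ℕ} {V W : Set (Coord m)} {y : Coord m} {F : Coord m → Coord m}
  {G' G : Coord m → Matrix (Fin (m + 1)) (Fin (m + 1)) ℝ}
  {U' U v' v w' w : Coord m → Fin (m + 1) → ℝ}

/-- Differentiating `v ∘ F = J v'` produces a term `(∂ᵢJ) v'`, which is exactly the inhomogeneous
term of the connection law. -/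
theorem covVec_eq (h : IsPullback F V W G' G) (hv : ∀ i, ContDiffOn ℝ ∞ (fun z => v z i) W)
    (hvv : ∀ z ∈ V, col v (F z) = jac F z * col v' z) (hy : y ∈ V) (i : Fin (m + 1)) :
    jac F y * covVec G' v' i y = ∑ a, jac F y a i • covVec G v a (F y) := by
  have hJ := mSmooth_jac h.isOpen_left h.smooth
  have hcol : MSmooth (col v) W := fun i _ => hv i
  -- Smoothness of `v'` is not assumed; it follows from `v' = J⁻¹ (v ∘ F)`.
  have hv' : MSmooth (col v') V := by
    refine ((hJ.inv h.det_jac).mul (hcol.comp h.smooth h.mapsTo)).congr fun z hz => ?_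
    rw [hvv z hz, ← Matrix.mul_assoc, Matrix.nonsing_inv_mul _ (h.det_jac z hz).isUnit,
      Matrix.one_mul]
  have h1 : mpd i (fun z => col v (F z)) y = mpd i (fun z => jac F z * col v' z) y :=
    mpd_congr h.isOpen_left hvv hy i
  rw [mpd_mul h.isOpen_left hJ hv' hy,
    mpd_comp h.isOpen_left h.isOpen_right h.smooth h.mapsTo hcol hy] at h1
  simp only [covVec, smul_add, Finset.sum_add_distrib]
  rw [h1, Matrix.mul_add, ← Matrix.mul_assoc, h.jac_mul_conn hy, Matrix.add_mul, Matrix.mul_assoc,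
    ← hvv y hy, pullConn, Matrix.sum_mul]
  simp only [Matrix.smul_mul]
  abel

/-- The two matrices of covariant derivatives are conjugate by `J`, hence have the same trace. -/
theorem divergence_eq (h : IsPullback F V W G' G) (hv : ∀ i, ContDiffOn ℝ ∞ (fun z => v z i) W)
    (hvv : ∀ z ∈ V, col v (F z) = jac F z * col v' z) (hy : y ∈ V) :
    divergence G' v' y = divergence G v (F y) := by
  rw [divergence_eq_trace, divergence_eq_trace]
  set N' : Matrix (Fin (m + 1)) (Fin (m + 1)) ℝ := Matrix.of fun p i => covVec G' v' i y p ()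
  set N : Matrix (Fin (m + 1)) (Fin (m + 1)) ℝ := Matrix.of fun p i => covVec G v i (F y) p ()
  have hN : jac F y * N' = N * jac F y := by
    ext p i
    have := congrFun (congrFun (h.covVec_eq hv hvv hy i) p) ()
    simp only [Matrix.mul_apply, Matrix.sum_apply, Matrix.smul_apply, smul_eq_mul] at this
    simp only [Matrix.mul_apply, N, N', Matrix.of_apply, this]
    exact Finset.sum_congr rfl fun a _ => mul_comm _ _
  have hu := (h.det_jac y hy).isUnit
  have : N' = (jac F y)⁻¹ * (N * jac F y) := by
    rw [← hN, ← Matrix.mul_assoc, Matrix.nonsing_inv_mul _ hu, Matrix.one_mul]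
  rw [this, Matrix.trace_mul_comm, Matrix.mul_assoc, Matrix.mul_nonsing_inv _ hu, Matrix.mul_one]

theorem covD_transform (h : IsPullback F V W G' G) (hw : ∀ i, ContDiffOn ℝ ∞ (fun z => w z i) W)
    (hww : ∀ z ∈ V, col w' z = (jac F z).transpose * col w (F z)) (hy : y ∈ V)
    (i j : Fin (m + 1)) :
    covD G' w' i j y = ∑ a, jac F y a i * ∑ b, jac F y b j * covD G w a b (F y) := by
  have hJ := mSmooth_jac h.isOpen_left h.smooth
  have hcol : MSmooth (col w) W := fun i _ => hw i
  have h1 : mpd i (col w') y - (conn G' i y).transpose * col w' y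
      = ∑ a, jac F y a i • ((jac F y).transpose *
        (mpd a (col w) (F y) - (conn G a (F y)).transpose * col w (F y))) := by
    rw [mpd_congr h.isOpen_left hww hy, mpd_mul h.isOpen_left hJ.transpose
      (hcol.comp h.smooth h.mapsTo) hy, hww y hy, ← Matrix.mul_assoc, ← Matrix.transpose_mul,
      h.jac_mul_conn hy, mpd_comp h.isOpen_left h.isOpen_right h.smooth h.mapsTo hcol hy,
      mpd_transpose, Matrix.transpose_add, Matrix.transpose_mul, pullConn, Matrix.transpose_sum]
    simp only [Matrix.mul_sub, smul_sub, Finset.sum_sub_distrib, Matrix.add_mul, Matrix.mul_sum,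
      Matrix.sum_mul, Matrix.mul_smul, Matrix.smul_mul, Matrix.transpose_smul, Matrix.mul_assoc]
    abel
  rw [covD_eq, h1]
  simp only [Matrix.sum_apply, Matrix.smul_apply, Matrix.mul_apply, Matrix.transpose_apply,
    smul_eq_mul, ← covD_eq]

theorem dotD_eq (h : IsPullback F V W G' G)
    (hUU : ∀ z ∈ V, col U (F z) = jac F z * col U' z)
    {k' k : Coord m → ℝ} (hk : ContDiffOn ℝ ∞ k W) (hkk : ∀ z ∈ V, k' z = k (F z)) (hy : y ∈ V) :
    dotD U' k' y = dotD U k (F y) := by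
  have hU : ∀ a, U (F y) a = ∑ i, jac F y a i * U' y i := fun a =>
    congrFun (congrFun (hUU y hy) a) ()
  unfold dotD
  simp only [hU, Finset.sum_mul]
  rw [Finset.sum_comm]
  refine Finset.sum_congr rfl fun i _ => ?_
  rw [pd_congr h.isOpen_left hkk hy, pd_comp
    ((h.smooth.contDiffAt (h.isOpen_left.mem_nhds hy)).differentiableAt (by simp))
    (differentiableAt_of_smoothOn h.isOpen_right hk (h.mapsTo hy)), Finset.mul_sum]
  exact Finset.sum_congr rfl fun a _ => by ring

theorem pd_eq (h : IsPullback F V W G' G) {k' k : Coord m → ℝ} (hk : ContDiffOn ℝ ∞ k W)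
    (hkk : ∀ z ∈ V, k' z = k (F z)) (hy : y ∈ V) (i : Fin (m + 1)) :
    pd i k' y = ∑ a, jac F y a i * pd a k (F y) := by
  rw [pd_congr h.isOpen_left hkk hy, pd_comp
    ((h.smooth.contDiffAt (h.isOpen_left.mem_nhds hy)).differentiableAt (by simp))
    (differentiableAt_of_smoothOn h.isOpen_right hk (h.mapsTo hy))]
  exact Finset.sum_congr rfl fun a _ => mul_comm _ _

theorem lower_eq (h : IsPullback F V W G' G)
    (hUU : ∀ z ∈ V, col U (F z) = jac F z * col U' z) (hy : y ∈ V) :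
    col (lower G' U') y = (jac F y).transpose * col (lower G U) (F y) := by
  have h1 : ∀ (G : Coord m → Matrix (Fin (m + 1)) (Fin (m + 1)) ℝ) U z,
    col (lower G U) z = G z * col U z := fun _ _ _ => rfl
  rw [h1, h1, hUU y hy, h.metric_eq y hy]
  simp only [Matrix.mul_assoc]

theorem accel_eq (h : IsPullback F V W G' G) (hU : ∀ i, ContDiffOn ℝ ∞ (fun z => U z i) W)
    (hUU : ∀ z ∈ V, col U (F z) = jac F z * col U' z) (hy : y ∈ V) (j : Fin (m + 1)) :
    accel G' U' y j = ∑ b, jac F y b j * accel G U (F y) b := by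
  have hU' : ∀ a, U (F y) a = ∑ i, jac F y a i * U' y i := fun a =>
    congrFun (congrFun (hUU y hy) a) ()
  unfold accel
  simp only [hU', h.covD_transform (smoothOn_lower h.metric_smooth hU)
    (fun z hz => h.lower_eq hUU hz) hy]
  simp only [Finset.mul_sum, Finset.sum_mul]
  rw [sum_reverse]
  exact Finset.sum_congr rfl fun b _ => Finset.sum_congr rfl fun a _ =>
    Finset.sum_congr rfl fun i _ => by ring

theorem divAccel_eq (h : IsPullback F V W G' G) (hU : ∀ i, ContDiffOn ℝ ∞ (fun z => U z i) W)
    (hUU : ∀ z ∈ V, col U (F z) = jac F z * col U' z) (hy : y ∈ V) :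
    divAccel G' U' y = divAccel G U (F y) := by
  refine h.divergence_eq (smoothOn_raise h.metric_smooth h.metric_det
    (smoothOn_accel h.isOpen_right h.metric_smooth h.metric_det hU)) (fun z hz => ?_) hy
  have h1 : ∀ (G : Coord m → Matrix (Fin (m + 1)) (Fin (m + 1)) ℝ) w z,
    col (raise G w) z = (G z)⁻¹ * col w z := fun _ _ _ => rfl
  have h2 : col (accel G' U') z = (jac F z).transpose * col (accel G U) (F z) := by
    ext i _
    exact h.accel_eq hU hUU hz i
  have hu := (h.det_jac z hz).isUnit
  have hu' : IsUnit (jac F z).transpose.det := by rwa [Matrix.det_transpose]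
  rw [h1, h1, h2, h.metric_eq z hz, Matrix.mul_inv_rev, Matrix.mul_inv_rev]
  simp only [Matrix.mul_assoc]
  rw [Matrix.mul_nonsing_inv_cancel_left _ _ hu, Matrix.nonsing_inv_mul_cancel_left _ _ hu']

theorem expansion_eq (h : IsPullback F V W G' G) (hU : ∀ i, ContDiffOn ℝ ∞ (fun z => U z i) W)
    (hUU : ∀ z ∈ V, col U (F z) = jac F z * col U' z) (hy : y ∈ V) :
    expansion G' U' y = expansion G U (F y) := by
  rw [expansion, expansion, h.divergence_eq hU hUU hy]

theorem xi_eq (h : IsPullback F V W G' G) (hU : ∀ i, ContDiffOn ℝ ∞ (fun z => U z i) W)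
    (hUU : ∀ z ∈ V, col U (F z) = jac F z * col U' z) (hy : y ∈ V) :
    xi G' U' y = xi G U (F y) := by
  rw [xi, xi, h.expansion_eq hU hUU hy, h.dotD_eq hUU (smoothOn_expansion h.isOpen_right
    h.metric_smooth h.metric_det hU) (fun z hz => h.expansion_eq hU hUU hz) hy]

/-- The transformation law of the curvature endomorphisms. -/
theorem jac_mul_curv (h : IsPullback F V W G' G) (hy : y ∈ V) (j k : Fin (m + 1)) :
    jac F y * curv G' j k y
      = (∑ a, ∑ b, (jac F y a j * jac F y b k) • curv G a b (F y)) * jac F y := by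
  have hJ := mSmooth_jac h.isOpen_left h.smooth
  have hΓ := mSmooth_conn h.isOpen_right h.metric_smooth h.metric_det
  have hΓ' := mSmooth_conn h.isOpen_left h.mSmooth_left h.det_left
  -- The connection law differentiated once more. The term `∂ₖ∂ⱼJ` is symmetric in `j` and `k`, so
  -- it drops out of the curvature.
  have hlaw : ∀ j k, mpd k (jac F) y * conn G' j y + jac F y * mpd k (conn G' j) y
      = mpd k (pullConn F G j) y * jac F y + pullConn F G j y * mpd k (jac F) y
        + mpd k (mpd j (jac F)) y := by
    intro j k
    rw [← mpd_mul h.isOpen_left hJ (hΓ' j) hy,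
      mpd_congr h.isOpen_left (fun z hz => h.jac_mul_conn hz j) hy,
      mpd_add h.isOpen_left ((h.mSmooth_pullConn j).mul hJ) (hJ.mpd h.isOpen_left j) hy,
      mpd_mul h.isOpen_left (h.mSmooth_pullConn j) hJ hy]
  have hA : ∀ j k, mpd k (pullConn F G j) y = ∑ a, pd k (fun z => jac F z a j) y • conn G a (F y)
      + ∑ a, ∑ b, (jac F y a j * jac F y b k) • mpd b (conn G a) (F y) := by
    intro j k
    have := mpd_sum (F := fun a z => jac F z a j • conn G a (F z)) h.isOpen_left
      (fun a => MSmooth.smul (smoothOn_jac h.isOpen_left h.smooth a j)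
        ((hΓ a).comp h.smooth h.mapsTo)) hy k
    unfold pullConn
    rw [this, ← Finset.sum_add_distrib]
    refine Finset.sum_congr rfl fun a _ => ?_
    rw [mpd_smul h.isOpen_left (smoothOn_jac h.isOpen_left h.smooth a j)
      ((hΓ a).comp h.smooth h.mapsTo) hy,
      mpd_comp h.isOpen_left h.isOpen_right h.smooth h.mapsTo (hΓ a) hy, Finset.smul_sum]
    simp only [smul_smul]
  have hAA : ∀ j k, pullConn F G k y * pullConn F G j y
      = ∑ a, ∑ b, (jac F y a j * jac F y b k) • (conn G b (F y) * conn G a (F y)) := by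
    intro j k
    simp only [pullConn, Finset.sum_mul, Finset.mul_sum, Matrix.smul_mul, Matrix.mul_smul,
      smul_smul]
  have hflip : ∀ T : Fin (m + 1) → Fin (m + 1) → Matrix (Fin (m + 1)) (Fin (m + 1)) ℝ,
      ∑ a, ∑ b, (jac F y a k * jac F y b j) • T a b
        = ∑ a, ∑ b, (jac F y a j * jac F y b k) • T b a := by
    intro T
    rw [Finset.sum_comm]
    simp only [mul_comm]
  -- The pulled-back curvature is the curvature expression of the matrices `Aᵢ`: the derivatives of
  -- the Jacobian coefficients cancel by symmetry of second derivatives.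
  have hS : ∑ a, ∑ b, (jac F y a j * jac F y b k) • curv G a b (F y)
      = mpd k (pullConn F G j) y - mpd j (pullConn F G k) y
        + pullConn F G k y * pullConn F G j y - pullConn F G j y * pullConn F G k y := by
    rw [hAA, hAA, hA, hA, hflip, hflip]
    simp only [curv, smul_add, smul_sub, Finset.sum_add_distrib, Finset.sum_sub_distrib,
      pd_jac_comm h.isOpen_left h.smooth hy _ j k]
    abel
  rw [hS]
  have e1 := hlaw j k
  have e2 := hlaw k j
  have e3 := h.jac_mul_conn hy j
  have e4 := h.jac_mul_conn hy k
  rw [mpd_comm h.isOpen_left hJ hy j k] at e2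
  have e1' := eq_sub_of_add_eq' e1
  have e2' := eq_sub_of_add_eq' e2
  rw [curv, Matrix.mul_sub, Matrix.mul_add, Matrix.mul_sub, e1', e2', ← Matrix.mul_assoc,
    ← Matrix.mul_assoc, e3, e4]
  simp only [Matrix.add_mul, Matrix.sub_mul, Matrix.mul_assoc, e3, e4, Matrix.mul_add]
  abel

theorem ricci_eq (h : IsPullback F V W G' G) (hy : y ∈ V) :
    (Matrix.of fun j l => ricci G' j l y)
      = (jac F y).transpose * (Matrix.of fun j l => ricci G j l (F y)) * jac F y := by
  set J := jac F y with hJdef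
  have hu : IsUnit J.det := (h.det_jac y hy).isUnit
  have hcurv : ∀ j k, curv G' j k y
      = J⁻¹ * ((∑ a, ∑ b, (J a j * J b k) • curv G a b (F y)) * J) := by
    intro j k
    rw [← h.jac_mul_curv hy, ← Matrix.mul_assoc, Matrix.nonsing_inv_mul _ hu, Matrix.one_mul]
  -- The contracted pair consists of an upper index transforming with `J⁻¹` and a lower one
  -- transforming with `J`; the two factors annihilate each other.
  have hcontr : ∀ T : Fin (m + 1) → Fin (m + 1) → ℝ,
      ∑ k, ∑ c, J⁻¹ k c * ∑ b, J b k * T b c = ∑ b, T b b := by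
    intro T
    have h1 : ∀ b c, ∑ k, J b k * J⁻¹ k c = (1 : Matrix (Fin (m + 1)) (Fin (m + 1)) ℝ) b c := by
      intro b c
      rw [← Matrix.mul_apply, Matrix.mul_nonsing_inv _ hu]
    calc ∑ k, ∑ c, J⁻¹ k c * ∑ b, J b k * T b c
        = ∑ c, ∑ k, ∑ b, J b k * J⁻¹ k c * T b c := by
          rw [Finset.sum_comm]
          simp only [Finset.mul_sum]
          exact Finset.sum_congr rfl fun c _ => Finset.sum_congr rfl fun k _ =>
            Finset.sum_congr rfl fun b _ => by ring
      _ = ∑ c, ∑ b, (∑ k, J b k * J⁻¹ k c) * T b c := by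
          refine Finset.sum_congr rfl fun c _ => ?_
          rw [Finset.sum_comm]
          simp only [Finset.sum_mul]
      _ = ∑ b, T b b := by
          simp only [h1, Matrix.one_apply, ite_mul, one_mul, zero_mul, Finset.sum_ite_eq',
            Finset.mem_univ, if_true]
  ext j l
  have h2 : ∀ k, curv G' j k y k l
      = ∑ c, J⁻¹ k c * ∑ b, J b k * ∑ a, ∑ d, J a j * curv G a b (F y) c d * J d l := by
    intro k
    rw [hcurv, Matrix.mul_apply]
    refine Finset.sum_congr rfl fun c _ => ?_
    congr 1
    simp only [Matrix.mul_apply, Matrix.sum_apply, Matrix.smul_apply, smul_eq_mul, Finset.sum_mul,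
      Finset.mul_sum]
    rw [sum_reverse]
    exact Finset.sum_congr rfl fun b _ => Finset.sum_congr rfl fun a _ =>
      Finset.sum_congr rfl fun d _ => by ring
  simp only [Matrix.of_apply, ricci, riemann_eq_curv, h2]
  rw [hcontr fun b c => ∑ a, ∑ d, J a j * curv G a b (F y) c d * J d l]
  simp only [Matrix.mul_apply, Matrix.transpose_apply, Matrix.of_apply, Finset.sum_mul,
    Finset.mul_sum]
  rw [sum_reverse]

theorem scalarCurv_eq (h : IsPullback F V W G' G) (hy : y ∈ V) :
    scalarCurv G' y = scalarCurv G (F y) := by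
  have hu := (h.det_jac y hy).isUnit
  have hu' : IsUnit (jac F y).transpose.det := by rwa [Matrix.det_transpose]
  rw [scalarCurv_eq_trace, scalarCurv_eq_trace, h.ricci_eq hy, h.metric_eq y hy,
    Matrix.transpose_mul, Matrix.transpose_mul, Matrix.transpose_transpose, Matrix.mul_inv_rev,
    Matrix.mul_inv_rev]
  set J := jac F y
  set R := (Matrix.of fun j l => ricci G j l (F y))
  rw [Matrix.mul_assoc J⁻¹, Matrix.mul_assoc (G (F y))⁻¹, ← Matrix.mul_assoc J.transpose⁻¹,
    Matrix.nonsing_inv_mul _ hu', Matrix.one_mul, Matrix.trace_mul_comm, Matrix.mul_assoc,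
    Matrix.mul_assoc, Matrix.mul_nonsing_inv _ hu, Matrix.mul_one]

end IsPullback

/-! ### Functions independent of one coordinate -/

section Indep

variable {m : ℕ} {X : Type*} {i : Fin (m + 1)} {f g : Coord m → ℝ}

/-- The function `f` does not depend on the `i`-th coordinate. -/
def Indep (i : Fin (m + 1)) (f : Coord m → X) : Prop :=
  ∀ (y : Coord m) (s : ℝ), f (y + s • basisVec i) = f y

/-- No differentiability is required: where `f` is not differentiable, `fderiv` is zero by
convention. -/
theorem Indep.pd_eq_zero (hf : Indep i f) (y : Coord m) : pd i f y = 0 := by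
  unfold pd
  by_cases hd : DifferentiableAt ℝ f y
  · rw [← hd.lineDeriv_eq_fderiv, lineDeriv]
    simp only [hf y, deriv_const]
  · rw [fderiv_zero_of_not_differentiableAt hd]; rfl

/-- Independence is invariance under translations of the whole space, and `fderiv` commutes with
translations without any smoothness. -/
theorem Indep.pd (hf : Indep i f) (j : Fin (m + 1)) : Indep i (pd j f) := by
  intro y s
  unfold DoublyWarped.pd
  rw [← fderiv_comp_add_right]
  simp only [hf _ s]

theorem Indep.add (hf : Indep i f) (hg : Indep i g) : Indep i (fun y => f y + g y) :=
  fun y s => by simp only [hf y s, hg y s]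

theorem Indep.sub (hf : Indep i f) (hg : Indep i g) : Indep i (fun y => f y - g y) :=
  fun y s => by simp only [hf y s, hg y s]

theorem Indep.mul (hf : Indep i f) (hg : Indep i g) : Indep i (fun y => f y * g y) :=
  fun y s => by simp only [hf y s, hg y s]

theorem Indep.div (hf : Indep i f) (hg : Indep i g) : Indep i (fun y => f y / g y) :=
  fun y s => by simp only [hf y s, hg y s]

theorem Indep.const (c : ℝ) : Indep i (fun _ : Coord m => c) := fun _ _ => rfl

theorem Indep.sum {ι : Type*} [Fintype ι] {F : ι → Coord m → ℝ} (hF : ∀ k, Indep i (F k)) :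
    Indep i (fun y => ∑ k, F k y) :=
  fun y s => Finset.sum_congr rfl fun k _ => hF k y s

end Indep

/-! ### The doubly warped metric in comoving coordinates -/

/-- The doubly warped metric matrix with scale factor `α`, lapse `β` and spatial metric `γ`. -/
def warpedMetric {m : ℕ} (α β : Coord m → ℝ) (γ : Coord m → Matrix (Fin m) (Fin m) ℝ)
    (y : Coord m) : Matrix (Fin (m + 1)) (Fin (m + 1)) ℝ :=
  warpedMatrix (α y) (β y) (γ y)

/-- The comoving unit velocity `β⁻¹ ∂/∂t`. -/
def comovingVelocity {m : ℕ} (β : Coord m → ℝ) (y : Coord m) : Fin (m + 1) → ℝ :=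
  Fin.cons (β y)⁻¹ (fun _ => 0)

/-- On the open set `W`, the scale factor `α` depends on time only, the lapse `β` and the spatial
metric `γ` do not depend on time, and all are smooth and nondegenerate. -/
structure IsWarpedModel {m : ℕ} (W : Set (Coord m)) (α β : Coord m → ℝ)
    (γ : Coord m → Matrix (Fin m) (Fin m) ℝ) : Prop where
  isOpen : IsOpen W
  smooth_scale : ContDiffOn ℝ ∞ α W
  smooth_lapse : ContDiffOn ℝ ∞ β W
  smooth_space : MSmooth γ W
  indep_scale : ∀ μ : Fin m, Indep μ.succ α
  indep_lapse : Indep 0 β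
  indep_space : Indep 0 γ
  scale_ne : ∀ y ∈ W, α y ≠ 0
  lapse_ne : ∀ y ∈ W, β y ≠ 0
  space_symm : ∀ y ∈ W, (γ y).IsSymm
  space_det : ∀ y ∈ W, (γ y).det ≠ 0

namespace IsWarpedModel

variable {m : ℕ} {W : Set (Coord m)} {α β : Coord m → ℝ}
  {γ : Coord m → Matrix (Fin m) (Fin m) ℝ} {y : Coord m}

@[simp] theorem warpedMetric_zero_zero : warpedMetric α β γ y 0 0 = -(β y) ^ 2 := rfl
@[simp] theorem warpedMetric_zero_succ (ν : Fin m) : warpedMetric α β γ y 0 ν.succ = 0 := rfl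
@[simp] theorem warpedMetric_succ_zero (μ : Fin m) : warpedMetric α β γ y μ.succ 0 = 0 := rfl
@[simp] theorem warpedMetric_succ_succ (μ ν : Fin m) :
    warpedMetric α β γ y μ.succ ν.succ = α y ^ 2 * γ y μ ν := rfl

@[simp] theorem comovingVelocity_zero : comovingVelocity β y 0 = (β y)⁻¹ := rfl
@[simp] theorem comovingVelocity_succ (μ : Fin m) : comovingVelocity β y μ.succ = 0 := rfl

/-- The inverse of the doubly warped metric matrix. -/
def warpedInv (α β : Coord m → ℝ) (γ : Coord m → Matrix (Fin m) (Fin m) ℝ) (y : Coord m) :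
    Matrix (Fin (m + 1)) (Fin (m + 1)) ℝ :=
  Matrix.of (Fin.cons (Fin.cons (-(β y ^ 2)⁻¹) (fun _ => 0))
    (fun μ => Fin.cons 0 (fun ν => (α y ^ 2)⁻¹ * (γ y)⁻¹ μ ν)))

@[simp] theorem warpedInv_zero_zero : warpedInv α β γ y 0 0 = -(β y ^ 2)⁻¹ := rfl
@[simp] theorem warpedInv_zero_succ (ν : Fin m) : warpedInv α β γ y 0 ν.succ = 0 := rfl
@[simp] theorem warpedInv_succ_zero (μ : Fin m) : warpedInv α β γ y μ.succ 0 = 0 := rfl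
@[simp] theorem warpedInv_succ_succ (μ ν : Fin m) :
    warpedInv α β γ y μ.succ ν.succ = (α y ^ 2)⁻¹ * (γ y)⁻¹ μ ν := rfl

theorem mul_warpedInv (h : IsWarpedModel W α β γ) (hy : y ∈ W) :
    warpedMetric α β γ y * warpedInv α β γ y = 1 := by
  have ha := h.scale_ne y hy
  have hb := h.lapse_ne y hy
  have hg : ∀ μ ν, ∑ l, γ y μ l * (γ y)⁻¹ l ν = (1 : Matrix (Fin m) (Fin m) ℝ) μ ν := by
    intro μ ν
    rw [← Matrix.mul_apply, Matrix.mul_nonsing_inv _ (h.space_det y hy).isUnit]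
  ext i j
  rw [Matrix.mul_apply, Fin.sum_univ_succ]
  refine Fin.cases ?_ (fun μ => ?_) i <;> refine Fin.cases ?_ (fun ν => ?_) j
  · simp; field_simp
  · simp [(Fin.succ_ne_zero ν).symm]
  · simp [Fin.succ_ne_zero μ]
  · simp only [warpedMetric_succ_zero, zero_mul, zero_add, warpedMetric_succ_succ,
      warpedInv_succ_succ]
    have : ∀ l, α y ^ 2 * γ y μ l * ((α y ^ 2)⁻¹ * (γ y)⁻¹ l ν) = γ y μ l * (γ y)⁻¹ l ν := by
      intro l; field_simp
    simp only [this, hg, Matrix.one_apply, Fin.succ_inj]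

theorem metric_det (h : IsWarpedModel W α β γ) : ∀ z ∈ W, (warpedMetric α β γ z).det ≠ 0 := by
  intro z hz h0
  have := congrArg Matrix.det (h.mul_warpedInv hz)
  rw [Matrix.det_mul, h0, zero_mul, Matrix.det_one] at this
  exact zero_ne_one this

theorem metric_inv (h : IsWarpedModel W α β γ) (hy : y ∈ W) :
    (warpedMetric α β γ y)⁻¹ = warpedInv α β γ y :=
  Matrix.inv_eq_right_inv (h.mul_warpedInv hy)

theorem metric_symm (h : IsWarpedModel W α β γ) :
    ∀ z ∈ W, (warpedMetric α β γ z).IsSymm := by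
  intro z hz
  ext i j
  refine Fin.cases ?_ (fun μ => ?_) i <;> refine Fin.cases ?_ (fun ν => ?_) j <;>
    simp [(h.space_symm z hz).apply]

theorem metric_smooth (h : IsWarpedModel W α β γ) : MSmooth (warpedMetric α β γ) W := by
  intro i j
  refine Fin.cases ?_ (fun μ => ?_) i <;> refine Fin.cases ?_ (fun ν => ?_) j
  · exact (h.smooth_lapse.pow 2).neg
  · exact contDiffOn_const
  · exact contDiffOn_const
  · exact (h.smooth_scale.pow 2).mul (h.smooth_space μ ν)

theorem velocity_smooth (h : IsWarpedModel W α β γ) (i : Fin (m + 1)) :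
    ContDiffOn ℝ ∞ (fun z => comovingVelocity β z i) W := by
  refine Fin.cases ?_ (fun μ => ?_) i
  · exact h.smooth_lapse.inv h.lapse_ne
  · exact contDiffOn_const

theorem diff_scale (h : IsWarpedModel W α β γ) (hy : y ∈ W) : DifferentiableAt ℝ α y :=
  differentiableAt_of_smoothOn h.isOpen h.smooth_scale hy

theorem diff_lapse (h : IsWarpedModel W α β γ) (hy : y ∈ W) : DifferentiableAt ℝ β y :=
  differentiableAt_of_smoothOn h.isOpen h.smooth_lapse hy

theorem diff_space (h : IsWarpedModel W α β γ) (hy : y ∈ W) (μ ν : Fin m) :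
    DifferentiableAt ℝ (fun z => γ z μ ν) y :=
  differentiableAt_of_smoothOn h.isOpen (h.smooth_space μ ν) hy

theorem indep_space_apply (h : IsWarpedModel W α β γ) (μ ν : Fin m) :
    Indep 0 (fun z => γ z μ ν) := fun z s => by simp only [h.indep_space z s]

theorem indep_space_inv (h : IsWarpedModel W α β γ) (μ ν : Fin m) :
    Indep 0 (fun z => (γ z)⁻¹ μ ν) := fun z s => by simp only [h.indep_space z s]

theorem pd_scale_sq (h : IsWarpedModel W α β γ) (μ : Fin m) :
    pd μ.succ (fun z => α z ^ 2) y = 0 :=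
  Indep.pd_eq_zero (fun z s => by rw [h.indep_scale μ z s]) y

theorem pd_sq {f : Coord m → ℝ} (hf : DifferentiableAt ℝ f y) (i : Fin (m + 1)) :
    pd i (fun z => f z ^ 2) y = 2 * f y * pd i f y := by
  simp only [pow_two]
  rw [pd_mul hf hf]; ring

theorem pd_neg (f : Coord m → ℝ) (i : Fin (m + 1)) : pd i (fun z => -f z) y = -pd i f y := by
  unfold pd; rw [fderiv_fun_neg]; rfl

theorem pd_metric_zero_zero_zero (h : IsWarpedModel W α β γ) :
    pd 0 (fun z => warpedMetric α β γ z 0 0) y = 0 :=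
  Indep.pd_eq_zero (fun z s => by simp [h.indep_lapse z s]) y

theorem pd_metric_succ_zero_zero (h : IsWarpedModel W α β γ) (hy : y ∈ W) (μ : Fin m) :
    pd μ.succ (fun z => warpedMetric α β γ z 0 0) y = -2 * β y * pd μ.succ β y := by
  simp only [warpedMetric_zero_zero]
  rw [pd_neg, pd_sq (h.diff_lapse hy)]; ring

theorem pd_metric_zero_succ (i : Fin (m + 1)) (ν : Fin m) :
    pd i (fun z => warpedMetric α β γ z 0 ν.succ) y = 0 := pd_const 0 i

theorem pd_metric_succ_zero (i : Fin (m + 1)) (ν : Fin m) :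
    pd i (fun z => warpedMetric α β γ z ν.succ 0) y = 0 := pd_const 0 i

theorem pd_metric_zero_succ_succ (h : IsWarpedModel W α β γ) (hy : y ∈ W) (μ ν : Fin m) :
    pd 0 (fun z => warpedMetric α β γ z μ.succ ν.succ) y = 2 * α y * pd 0 α y * γ y μ ν := by
  simp only [warpedMetric_succ_succ]
  rw [pd_mul ((h.diff_scale hy).fun_pow 2) (h.diff_space hy μ ν), pd_sq (h.diff_scale hy),
    (h.indep_space_apply μ ν).pd_eq_zero]
  ring

theorem pd_metric_succ_succ_succ (h : IsWarpedModel W α β γ) (hy : y ∈ W) (l μ ν : Fin m) :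
    pd l.succ (fun z => warpedMetric α β γ z μ.succ ν.succ) y
      = α y ^ 2 * pd l.succ (fun z => γ z μ ν) y := by
  simp only [warpedMetric_succ_succ]
  rw [pd_mul ((h.diff_scale hy).fun_pow 2) (h.diff_space hy μ ν), h.pd_scale_sq]
  ring

/-- The gradient `γ^{ρν} ∂_ν β` of the lapse in the spatial metric. -/
def lapseGrad (β : Coord m → ℝ) (γ : Coord m → Matrix (Fin m) (Fin m) ℝ) (ρ : Fin m)
    (y : Coord m) : ℝ :=
  ∑ ν : Fin m, (γ y)⁻¹ ρ ν * pd ν.succ β y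

/-- The Christoffel symbols of the spatial metric. -/
def spaceChristoffel (γ : Coord m → Matrix (Fin m) (Fin m) ℝ) (ρ μ ν : Fin m)
    (y : Coord m) : ℝ :=
  (1 / 2) * ∑ l : Fin m, (γ y)⁻¹ ρ l * (pd μ.succ (fun z => γ z ν l) y
    + pd ν.succ (fun z => γ z μ l) y - pd l.succ (fun z => γ z μ ν) y)

theorem indep_lapseGrad (h : IsWarpedModel W α β γ) (ρ : Fin m) : Indep 0 (lapseGrad β γ ρ) :=
  Indep.sum fun ν => (h.indep_space_inv ρ ν).mul (h.indep_lapse.pd _)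

theorem smooth_lapseGrad (h : IsWarpedModel W α β γ) (ρ : Fin m) :
    ContDiffOn ℝ ∞ (lapseGrad β γ ρ) W :=
  ContDiffOn.sum fun ν _ => (h.smooth_space.inv h.space_det ρ ν).mul
    (smoothOn_pd h.isOpen h.smooth_lapse _)

theorem indep_spaceChristoffel (h : IsWarpedModel W α β γ) (ρ μ ν : Fin m) :
    Indep 0 (spaceChristoffel γ ρ μ ν) :=
  (Indep.const _).mul (Indep.sum fun l => (h.indep_space_inv ρ l).mul
    ((((h.indep_space_apply ν l).pd _).add ((h.indep_space_apply μ l).pd _)).sub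
      ((h.indep_space_apply μ ν).pd _)))

/-! ### Christoffel symbols of the warped metric -/

section Christoffel

theorem christoffel_zero_zero_zero (h : IsWarpedModel W α β γ) (hy : y ∈ W) :
    christoffel (warpedMetric α β γ) 0 0 0 y = 0 := by
  rw [christoffel, h.metric_inv hy, Fin.sum_univ_succ]
  simp only [warpedInv_zero_succ, zero_mul, Finset.sum_const_zero, h.pd_metric_zero_zero_zero]
  ring

theorem christoffel_zero_zero_succ (h : IsWarpedModel W α β γ) (hy : y ∈ W) (ν : Fin m) :
    christoffel (warpedMetric α β γ) 0 0 ν.succ y = pd ν.succ β y / β y := by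
  have hb := h.lapse_ne y hy
  rw [christoffel, h.metric_inv hy, Fin.sum_univ_succ]
  simp only [warpedInv_zero_succ, zero_mul, Finset.sum_const_zero, warpedInv_zero_zero,
    pd_metric_succ_zero, pd_metric_zero_succ, h.pd_metric_succ_zero_zero hy]
  field_simp
  ring

theorem christoffel_zero_succ_zero (h : IsWarpedModel W α β γ) (hy : y ∈ W) (ν : Fin m) :
    christoffel (warpedMetric α β γ) 0 ν.succ 0 y = pd ν.succ β y / β y := by
  rw [christoffel_symm h.isOpen h.metric_symm hy, h.christoffel_zero_zero_succ hy]

theorem christoffel_zero_succ_succ (h : IsWarpedModel W α β γ) (hy : y ∈ W) (μ ν : Fin m) :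
    christoffel (warpedMetric α β γ) 0 μ.succ ν.succ y
      = α y * pd 0 α y * (γ y μ ν / β y ^ 2) := by
  have hb := h.lapse_ne y hy
  rw [christoffel, h.metric_inv hy, Fin.sum_univ_succ]
  simp only [warpedInv_zero_succ, zero_mul, Finset.sum_const_zero, warpedInv_zero_zero,
    pd_metric_succ_zero, h.pd_metric_zero_succ_succ hy]
  field_simp
  ring

theorem christoffel_succ_zero_zero (h : IsWarpedModel W α β γ) (hy : y ∈ W) (ρ : Fin m) :
    christoffel (warpedMetric α β γ) ρ.succ 0 0 y
      = (α y ^ 2)⁻¹ * (β y * lapseGrad β γ ρ y) := by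
  rw [christoffel, h.metric_inv hy, Fin.sum_univ_succ]
  simp only [warpedInv_succ_zero, warpedInv_succ_succ, zero_mul, zero_add, pd_metric_zero_succ,
    h.pd_metric_succ_zero_zero hy, lapseGrad, Finset.mul_sum]
  exact Finset.sum_congr rfl fun l _ => by ring

theorem christoffel_succ_zero_succ (h : IsWarpedModel W α β γ) (hy : y ∈ W) (ρ ν : Fin m) :
    christoffel (warpedMetric α β γ) ρ.succ 0 ν.succ y
      = pd 0 α y / α y * (1 : Matrix (Fin m) (Fin m) ℝ) ρ ν := by
  have ha := h.scale_ne y hy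
  rw [christoffel, h.metric_inv hy, Fin.sum_univ_succ]
  simp only [warpedInv_succ_zero, warpedInv_succ_succ, zero_mul, zero_add, pd_metric_zero_succ,
    h.pd_metric_zero_succ_succ hy]
  rw [← Matrix.nonsing_inv_mul _ (h.space_det y hy).isUnit, Matrix.mul_apply, Finset.mul_sum,
    Finset.mul_sum]
  refine Finset.sum_congr rfl fun l _ => ?_
  rw [(h.space_symm y hy).apply l ν]
  field_simp
  ring

theorem christoffel_succ_succ_zero (h : IsWarpedModel W α β γ) (hy : y ∈ W) (ρ ν : Fin m) :
    christoffel (warpedMetric α β γ) ρ.succ ν.succ 0 y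
      = pd 0 α y / α y * (1 : Matrix (Fin m) (Fin m) ℝ) ρ ν := by
  rw [christoffel_symm h.isOpen h.metric_symm hy, h.christoffel_succ_zero_succ hy]

theorem christoffel_succ_succ_succ (h : IsWarpedModel W α β γ) (hy : y ∈ W) (ρ μ ν : Fin m) :
    christoffel (warpedMetric α β γ) ρ.succ μ.succ ν.succ y = spaceChristoffel γ ρ μ ν y := by
  have ha := h.scale_ne y hy
  rw [christoffel, h.metric_inv hy, Fin.sum_univ_succ, spaceChristoffel]
  simp only [warpedInv_succ_zero, warpedInv_succ_succ, zero_mul, zero_add,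
    h.pd_metric_succ_succ_succ hy]
  congr 1
  refine Finset.sum_congr rfl fun l _ => ?_
  field_simp

end Christoffel

end IsWarpedModel

theorem differentiableAt_div {m : ℕ} {f g : Coord m → ℝ} {y : Coord m}
    (hf : DifferentiableAt ℝ f y) (hg : DifferentiableAt ℝ g y) (hne : g y ≠ 0) :
    DifferentiableAt ℝ (fun z => f z / g z) y := by
  simp only [div_eq_mul_inv]
  exact hf.fun_mul (hg.fun_inv hne)

/-! ### Divergence and Ricci tensor through contracted Christoffel symbols -/

section Trace

variable {m : ℕ} {W : Set (Coord m)} {G : Coord m → Matrix (Fin (m + 1)) (Fin (m + 1)) ℝ}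
  {v : Coord m → Fin (m + 1) → ℝ} {y : Coord m}

/-- The contracted Christoffel symbols `Γᵏₖₗ`. -/
def christoffelTrace (G : Coord m → Matrix (Fin (m + 1)) (Fin (m + 1)) ℝ) (l : Fin (m + 1))
    (y : Coord m) : ℝ :=
  ∑ k, christoffel G k k l y

theorem divergence_eq_christoffelTrace :
    divergence G v y = ∑ p, pd p (fun z => v z p) y + ∑ k, christoffelTrace G k y * v y k := by
  simp only [divergence, christoffelTrace, Finset.sum_add_distrib, Finset.sum_mul]
  rw [Finset.sum_comm (f := fun p k => christoffel G p p k y * v y k)]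

/-- Only the contraction `Γᵏₖₗ` enters two of the four terms; for the warped metric it is much
simpler than the individual symbols. -/
theorem ricci_eq_christoffelTrace (hW : IsOpen W) (hG : MSmooth G W)
    (hdet : ∀ z ∈ W, (G z).det ≠ 0) (hy : y ∈ W) (j l : Fin (m + 1)) :
    ricci G j l y = -pd j (christoffelTrace G l) y + ∑ k, pd k (christoffel G k j l) y
      + ∑ p, christoffel G p j l y * christoffelTrace G p y
      - ∑ k, ∑ p, christoffel G p k l y * christoffel G k j p y := by
  have h1 : pd j (christoffelTrace G l) y = ∑ k, pd j (christoffel G k k l) y :=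
    pd_sum (fun k => differentiableAt_of_smoothOn hW (smoothOn_christoffel hW hG hdet k k l) hy) j
  simp only [ricci, riemann, Finset.sum_sub_distrib, Finset.sum_add_distrib,
    Finset.sum_neg_distrib, h1, christoffelTrace, Finset.mul_sum]
  rw [Finset.sum_comm (f := fun p k => christoffel G p j l y * christoffel G k k p y)]

end Trace

/-! ### Ricci and scalar curvature of the warped metric -/

namespace IsWarpedModel

variable {m : ℕ} {W : Set (Coord m)} {α β : Coord m → ℝ}
  {γ : Coord m → Matrix (Fin m) (Fin m) ℝ} {y : Coord m}

/-- The spatial components of the contracted Christoffel symbols. -/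
def spaceTrace (β : Coord m → ℝ) (γ : Coord m → Matrix (Fin m) (Fin m) ℝ) (ν : Fin m)
    (y : Coord m) : ℝ :=
  pd ν.succ β y / β y + ∑ ρ : Fin m, spaceChristoffel γ ρ ρ ν y

theorem indep_spaceTrace (h : IsWarpedModel W α β γ) (ν : Fin m) : Indep 0 (spaceTrace β γ ν) :=
  ((h.indep_lapse.pd _).div h.indep_lapse).add (Indep.sum fun ρ => h.indep_spaceChristoffel ρ ρ ν)

theorem christoffelTrace_zero (h : IsWarpedModel W α β γ) (hy : y ∈ W) :
    christoffelTrace (warpedMetric α β γ) 0 y = m * (pd 0 α y / α y) := by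
  rw [christoffelTrace, Fin.sum_univ_succ, h.christoffel_zero_zero_zero hy]
  simp only [h.christoffel_succ_succ_zero hy, Matrix.one_apply_eq, mul_one, Finset.sum_const,
    Finset.card_univ, Fintype.card_fin, nsmul_eq_mul, zero_add]

theorem christoffelTrace_succ (h : IsWarpedModel W α β γ) (hy : y ∈ W) (ν : Fin m) :
    christoffelTrace (warpedMetric α β γ) ν.succ y = spaceTrace β γ ν y := by
  rw [christoffelTrace, Fin.sum_univ_succ, h.christoffel_zero_zero_succ hy]
  simp only [h.christoffel_succ_succ_succ hy, spaceTrace]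

theorem diff_pd_scale (h : IsWarpedModel W α β γ) (hy : y ∈ W) :
    DifferentiableAt ℝ (pd 0 α) y :=
  differentiableAt_of_smoothOn h.isOpen (smoothOn_pd h.isOpen h.smooth_scale 0) hy

theorem pd_scale_mul (h : IsWarpedModel W α β γ) (hy : y ∈ W) :
    pd 0 (fun z => α z * pd 0 α z) y = pd 0 α y ^ 2 + α y * pd 0 (pd 0 α) y := by
  rw [pd_mul (h.diff_scale hy) (h.diff_pd_scale hy)]; ring

theorem pd_scale_div (h : IsWarpedModel W α β γ) (hy : y ∈ W) :
    pd 0 (fun z => pd 0 α z / α z) y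
      = pd 0 (pd 0 α) y / α y - pd 0 α y ^ 2 / α y ^ 2 := by
  have ha := h.scale_ne y hy
  have hd : DifferentiableAt ℝ (fun z => pd 0 α z / α z) y :=
    differentiableAt_div (h.diff_pd_scale hy) (h.diff_scale hy) ha
  -- The quotient rule, obtained by applying the product rule to `(α′/α) α = α′`.
  have h1 : pd 0 (fun z => pd 0 α z / α z * α z) y = pd 0 (pd 0 α) y :=
    pd_congr h.isOpen (fun z hz => div_mul_cancel₀ _ (h.scale_ne z hz)) hy 0
  rw [pd_mul hd (h.diff_scale hy)] at h1
  rw [← h1]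
  field_simp
  ring

theorem pd_scale_inv_sq_mul (h : IsWarpedModel W α β γ) {f : Coord m → ℝ}
    (hf : ContDiffOn ℝ ∞ f W) (hy : y ∈ W) (μ : Fin m) :
    pd μ.succ (fun z => (α z ^ 2)⁻¹ * f z) y = (α y ^ 2)⁻¹ * pd μ.succ f y := by
  have ha := h.scale_ne y hy
  rw [pd_mul (((h.diff_scale hy).fun_pow 2).fun_inv (pow_ne_zero 2 ha))
    (differentiableAt_of_smoothOn h.isOpen hf hy),
    Indep.pd_eq_zero (fun z s => by simp only [h.indep_scale μ z s])]
  ring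

/-- The stationary part of the Ricci component `R₀₀`. -/
def ricciTime (β : Coord m → ℝ) (γ : Coord m → Matrix (Fin m) (Fin m) ℝ) (y : Coord m) : ℝ :=
  ∑ ρ : Fin m, (pd ρ.succ (fun z => β z * lapseGrad β γ ρ z) y
    + β y * lapseGrad β γ ρ y * spaceTrace β γ ρ y
    - 2 * (β y * lapseGrad β γ ρ y * (pd ρ.succ β y / β y)))

/-- The stationary part of the spatial Ricci components. -/
def ricciSpace (β : Coord m → ℝ) (γ : Coord m → Matrix (Fin m) (Fin m) ℝ) (μ ν : Fin m)
    (y : Coord m) : ℝ :=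
  -pd μ.succ (spaceTrace β γ ν) y + ∑ ρ : Fin m, pd ρ.succ (spaceChristoffel γ ρ μ ν) y
    + ∑ ρ : Fin m, spaceChristoffel γ ρ μ ν y * spaceTrace β γ ρ y
    - (pd ν.succ β y / β y) * (pd μ.succ β y / β y)
    - ∑ k : Fin m, ∑ ρ : Fin m, spaceChristoffel γ ρ k ν y * spaceChristoffel γ k μ ρ y

theorem indep_ricciTime (h : IsWarpedModel W α β γ) : Indep 0 (ricciTime β γ) :=
  Indep.sum fun ρ =>
    have hg := h.indep_lapse.mul (h.indep_lapseGrad ρ)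
    ((hg.pd _).add (hg.mul (h.indep_spaceTrace ρ))).sub
      ((Indep.const 2).mul (hg.mul ((h.indep_lapse.pd _).div h.indep_lapse)))

theorem indep_ricciSpace (h : IsWarpedModel W α β γ) (μ ν : Fin m) :
    Indep 0 (ricciSpace β γ μ ν) := by
  have h1 : Indep 0 (fun z => -pd μ.succ (spaceTrace β γ ν) z) := fun z s => by
    simp only [(h.indep_spaceTrace ν).pd μ.succ z s]
  exact (((h1.add (Indep.sum fun ρ => (h.indep_spaceChristoffel ρ μ ν).pd _)).add
    (Indep.sum fun ρ => (h.indep_spaceChristoffel ρ μ ν).mul (h.indep_spaceTrace ρ))).sub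
    (((h.indep_lapse.pd _).div h.indep_lapse).mul ((h.indep_lapse.pd _).div h.indep_lapse))).sub
    (Indep.sum fun k => Indep.sum fun ρ =>
      (h.indep_spaceChristoffel ρ k ν).mul (h.indep_spaceChristoffel k μ ρ))

/-- The terms split into `α⁻²` times a stationary function and a part in `α` alone, in which the two
contributions `m (α′/α)²` cancel. -/
theorem ricci_zero_zero (h : IsWarpedModel W α β γ) (hy : y ∈ W) :
    ricci (warpedMetric α β γ) 0 0 y
      = (α y ^ 2)⁻¹ * ricciTime β γ y - m * (pd 0 (pd 0 α) y / α y) := by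
  have ha := h.scale_ne y hy
  have h0 : pd 0 (christoffelTrace (warpedMetric α β γ) 0) y
      = m * (pd 0 (pd 0 α) y / α y - pd 0 α y ^ 2 / α y ^ 2) := by
    rw [pd_congr h.isOpen (fun z hz => h.christoffelTrace_zero hz) hy,
      pd_mul (differentiableAt_const _)
        (differentiableAt_div (h.diff_pd_scale hy) (h.diff_scale hy) ha), pd_const, h.pd_scale_div hy]
    ring
  have h1 : pd 0 (christoffel (warpedMetric α β γ) 0 0 0) y = 0 := by
    rw [pd_congr h.isOpen (fun z hz => h.christoffel_zero_zero_zero hz) hy, pd_const]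
  have h2 : ∀ ρ : Fin m, pd ρ.succ (christoffel (warpedMetric α β γ) ρ.succ 0 0) y
      = (α y ^ 2)⁻¹ * pd ρ.succ (fun z => β z * lapseGrad β γ ρ z) y := by
    intro ρ
    rw [pd_congr h.isOpen (fun z hz => h.christoffel_succ_zero_zero hz ρ) hy,
      h.pd_scale_inv_sq_mul (h.smooth_lapse.mul (h.smooth_lapseGrad ρ)) hy]
  rw [ricci_eq_christoffelTrace h.isOpen h.metric_smooth h.metric_det hy]
  simp only [Fin.sum_univ_succ, h0, h1, h2, h.christoffelTrace_zero hy, h.christoffelTrace_succ hy,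
    h.christoffel_zero_zero_zero hy, h.christoffel_zero_zero_succ hy,
    h.christoffel_zero_succ_zero hy, h.christoffel_succ_zero_zero hy,
    h.christoffel_succ_zero_succ hy, h.christoffel_succ_succ_zero hy]
  have h3 : ∑ k : Fin m, ∑ ρ : Fin m, pd 0 α y / α y * (1 : Matrix (Fin m) (Fin m) ℝ) ρ k
      * (pd 0 α y / α y * (1 : Matrix (Fin m) (Fin m) ℝ) k ρ)
      = m * (pd 0 α y ^ 2 / α y ^ 2) := by
    simp only [Matrix.one_apply, mul_ite, mul_one, mul_zero, ite_mul, zero_mul]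
    simp
    left
    field_simp
  rw [Finset.sum_add_distrib, h3]
  simp only [ricciTime, Finset.mul_sum, mul_add, mul_sub, Finset.sum_add_distrib,
    Finset.sum_sub_distrib]
  -- The mixed products with `k` temporal, `p` spatial and with `k` spatial, `p` temporal are equal,
  -- whence the factor 2 in `ricciTime`.
  have h4 : ∑ ρ : Fin m, (α y ^ 2)⁻¹ * (2 * (β y * lapseGrad β γ ρ y * (pd ρ.succ β y / β y)))
      = ∑ ρ : Fin m, (α y ^ 2)⁻¹ * (β y * lapseGrad β γ ρ y) * (pd ρ.succ β y / β y)
      + ∑ ρ : Fin m, pd ρ.succ β y / β y * ((α y ^ 2)⁻¹ * (β y * lapseGrad β γ ρ y)) := by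
    rw [← Finset.sum_add_distrib]
    exact Finset.sum_congr rfl fun ρ _ => by ring
  rw [h4]
  simp only [← mul_assoc]
  ring

theorem ricci_succ_succ (h : IsWarpedModel W α β γ) (hy : y ∈ W) (μ ν : Fin m) :
    ricci (warpedMetric α β γ) μ.succ ν.succ y = ricciSpace β γ μ ν y
      + (α y * pd 0 (pd 0 α) y + (m - 1) * pd 0 α y ^ 2) * (γ y μ ν / β y ^ 2) := by
  have ha := h.scale_ne y hy
  have hb := h.lapse_ne y hy
  have h0 : pd μ.succ (christoffelTrace (warpedMetric α β γ) ν.succ) y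
      = pd μ.succ (spaceTrace β γ ν) y :=
    pd_congr h.isOpen (fun z hz => h.christoffelTrace_succ hz ν) hy _
  have h1 : pd 0 (christoffel (warpedMetric α β γ) 0 μ.succ ν.succ) y
      = (pd 0 α y ^ 2 + α y * pd 0 (pd 0 α) y) * (γ y μ ν / β y ^ 2) := by
    rw [pd_congr h.isOpen (fun z hz => h.christoffel_zero_succ_succ hz μ ν) hy,
      pd_mul ((h.diff_scale hy).fun_mul (h.diff_pd_scale hy))
        (differentiableAt_div (h.diff_space hy μ ν) ((h.diff_lapse hy).fun_pow 2) (pow_ne_zero 2 hb)),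
      h.pd_scale_mul hy, Indep.pd_eq_zero (f := fun z => γ z μ ν / β z ^ 2)
        (fun z s => by simp only [h.indep_space z s, h.indep_lapse z s])]
    ring
  have h2 : ∀ ρ : Fin m, pd ρ.succ (christoffel (warpedMetric α β γ) ρ.succ μ.succ ν.succ) y
      = pd ρ.succ (spaceChristoffel γ ρ μ ν) y := fun ρ =>
    pd_congr h.isOpen (fun z hz => h.christoffel_succ_succ_succ hz ρ μ ν) hy _
  rw [ricci_eq_christoffelTrace h.isOpen h.metric_smooth h.metric_det hy]
  simp only [Fin.sum_univ_succ, h0, h1, h2, h.christoffelTrace_zero hy, h.christoffelTrace_succ hy,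
    h.christoffel_zero_zero_succ hy, h.christoffel_zero_succ_zero hy,
    h.christoffel_zero_succ_succ hy, h.christoffel_succ_zero_succ hy,
    h.christoffel_succ_succ_zero hy, h.christoffel_succ_succ_succ hy]
  -- Origin of `m - 1`: `α′²` occurs once in `∂₀Γ⁰_{μν}`, `m` times through the contracted symbol,
  -- and is subtracted twice, by this sum and the next.
  have h3 : ∑ ρ : Fin m, pd 0 α y / α y * (1 : Matrix (Fin m) (Fin m) ℝ) ρ ν
      * (α y * pd 0 α y * (γ y μ ρ / β y ^ 2)) = pd 0 α y ^ 2 * (γ y μ ν / β y ^ 2) := by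
    simp only [Matrix.one_apply, mul_ite, mul_one, mul_zero, ite_mul, zero_mul]
    simp
    field_simp
  have h4 : ∑ ρ : Fin m, α y * pd 0 α y * (γ y ρ ν / β y ^ 2)
      * (pd 0 α y / α y * (1 : Matrix (Fin m) (Fin m) ℝ) ρ μ)
      = pd 0 α y ^ 2 * (γ y μ ν / β y ^ 2) := by
    simp only [Matrix.one_apply, mul_ite, mul_one, mul_zero]
    simp
    field_simp
  rw [Finset.sum_add_distrib, h3, h4, ricciSpace]
  field_simp
  ring

/-- The stationary part of the scalar curvature. -/
def scalarPart (β : Coord m → ℝ) (γ : Coord m → Matrix (Fin m) (Fin m) ℝ) (y : Coord m) : ℝ :=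
  ∑ μ : Fin m, ∑ ν : Fin m, (γ y)⁻¹ μ ν * ricciSpace β γ μ ν y - ricciTime β γ y / β y ^ 2

theorem indep_scalarPart (h : IsWarpedModel W α β γ) : Indep 0 (scalarPart β γ) :=
  (Indep.sum fun μ => Indep.sum fun ν =>
    (h.indep_space_inv μ ν).mul (h.indep_ricciSpace μ ν)).sub
    (h.indep_ricciTime.div fun z s => by simp only [h.indep_lapse z s])

/-- The time and space blocks each contribute `m α″/(αβ²)`, the latter through the trace `γ^{μν}
γ_{μν} = m`; everything stationary is collected in `scalarPart`. -/
theorem scalarCurv_warpedMetric (h : IsWarpedModel W α β γ) (hy : y ∈ W) :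
    scalarCurv (warpedMetric α β γ) y = scalarPart β γ y / α y ^ 2
      + (2 * m * (pd 0 (pd 0 α) y / α y) + m * (m - 1) * (pd 0 α y / α y) ^ 2) / β y ^ 2 := by
  have ha := h.scale_ne y hy
  have hb := h.lapse_ne y hy
  have htr : ∑ μ : Fin m, ∑ ν : Fin m, (γ y)⁻¹ μ ν * γ y μ ν = m := by
    have h1 : ∀ μ, ∑ ν : Fin m, (γ y)⁻¹ μ ν * γ y μ ν = 1 := by
      intro μ
      have h2 := congrFun (congrFun (Matrix.nonsing_inv_mul _ (h.space_det y hy).isUnit) μ) μ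
      rw [Matrix.mul_apply, Matrix.one_apply_eq] at h2
      rw [← h2]
      exact Finset.sum_congr rfl fun ν _ => by rw [(h.space_symm y hy).apply]
    simp [h1]
  simp only [scalarCurv, h.metric_inv hy, Fin.sum_univ_succ, warpedInv_zero_zero,
    warpedInv_zero_succ, warpedInv_succ_zero, warpedInv_succ_succ, zero_mul,
    Finset.sum_const_zero, add_zero, zero_add, h.ricci_zero_zero hy, h.ricci_succ_succ hy]
  have hsum : ∑ μ : Fin m, ∑ ν : Fin m, (α y ^ 2)⁻¹ * (γ y)⁻¹ μ ν * (ricciSpace β γ μ ν y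
      + (α y * pd 0 (pd 0 α) y + (m - 1) * pd 0 α y ^ 2) * (γ y μ ν / β y ^ 2))
      = (α y ^ 2)⁻¹ * ∑ μ : Fin m, ∑ ν : Fin m, (γ y)⁻¹ μ ν * ricciSpace β γ μ ν y
      + (α y ^ 2)⁻¹ * (α y * pd 0 (pd 0 α) y + (m - 1) * pd 0 α y ^ 2) / β y ^ 2 * m := by
    -- This replaces every real `m`, including the one in `m - 1`; the second use of `htr` restores
    -- that coefficient.
    rw [← htr]
    simp only [Finset.mul_sum, ← Finset.sum_add_distrib]
    rw [htr]
    exact Finset.sum_congr rfl fun μ _ => Finset.sum_congr rfl fun ν _ => by ring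
  rw [hsum, scalarPart]
  field_simp
  ring

end IsWarpedModel

/-! ### Kinematics of the comoving velocity and the three identities -/

namespace IsWarpedModel

variable {m : ℕ} {W : Set (Coord m)} {α β : Coord m → ℝ}
  {γ : Coord m → Matrix (Fin m) (Fin m) ℝ} {y : Coord m}

theorem dotD_comovingVelocity (f : Coord m → ℝ) (y : Coord m) :
    dotD (comovingVelocity β) f y = (β y)⁻¹ * pd 0 f y := by
  simp [dotD, Fin.sum_univ_succ]

/-- Valid at every point, since `0⁻¹ = 0` makes both sides vanish where the lapse does. It can
therefore be rewritten under a derivative without a membership condition. -/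
theorem lower_zero (y : Coord m) :
    lower (warpedMetric α β γ) (comovingVelocity β) y 0 = -β y := by
  rw [lower, Fin.sum_univ_succ]
  simp only [warpedMetric_zero_zero, comovingVelocity_zero, comovingVelocity_succ, mul_zero,
    Finset.sum_const_zero, add_zero]
  by_cases hb : β y = 0
  · simp [hb]
  · field_simp

theorem lower_succ (μ : Fin m) (y : Coord m) :
    lower (warpedMetric α β γ) (comovingVelocity β) y μ.succ = 0 := by
  simp [lower, Fin.sum_univ_succ]

theorem divergence_velocity (h : IsWarpedModel W α β γ) (hy : y ∈ W) :
    divergence (warpedMetric α β γ) (comovingVelocity β) y = m * (pd 0 α y / α y / β y) := by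
  rw [divergence_eq_christoffelTrace]
  simp only [Fin.sum_univ_succ, comovingVelocity_zero, comovingVelocity_succ, pd_const, mul_zero,
    Finset.sum_const_zero, add_zero, h.christoffelTrace_zero hy]
  rw [Indep.pd_eq_zero (fun z s => by simp only [h.indep_lapse z s])]
  ring

theorem expansion_warpedMetric (hm : 1 ≤ m) (h : IsWarpedModel W α β γ) (hy : y ∈ W) :
    expansion (warpedMetric α β γ) (comovingVelocity β) y = pd 0 α y / α y / β y := by
  have : (m : ℝ) ≠ 0 := by positivity
  rw [expansion, h.divergence_velocity hy]
  exact mul_div_cancel_left₀ _ this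

theorem pd_expansion (hm : 1 ≤ m) (h : IsWarpedModel W α β γ) (hy : y ∈ W) :
    pd 0 (expansion (warpedMetric α β γ) (comovingVelocity β)) y
      = (pd 0 (pd 0 α) y / α y - pd 0 α y ^ 2 / α y ^ 2) / β y := by
  have hb := h.lapse_ne y hy
  -- `φβ = α′/α` with `β` stationary, so differentiating the product isolates `∂₀φ`.
  have h1 : pd 0 (fun z => expansion (warpedMetric α β γ) (comovingVelocity β) z * β z) y
      = pd 0 (fun z => pd 0 α z / α z) y := by
    refine pd_congr h.isOpen (fun z hz => ?_) hy 0
    rw [h.expansion_warpedMetric hm hz, div_mul_cancel₀ _ (h.lapse_ne z hz)]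
  rw [pd_mul (differentiableAt_of_smoothOn h.isOpen (smoothOn_expansion h.isOpen h.metric_smooth
    h.metric_det h.velocity_smooth) hy) (h.diff_lapse hy), h.indep_lapse.pd_eq_zero,
    h.pd_scale_div hy] at h1
  rw [← h1]
  field_simp
  ring

/-- The term `-(α′/α)²/β²` in `φ̇` cancels `φ²`. As a consequence `ξβ²` is a function of time alone.
-/
theorem xi_warpedMetric (hm : 1 ≤ m) (h : IsWarpedModel W α β γ) (hy : y ∈ W) :
    xi (warpedMetric α β γ) (comovingVelocity β) y
      = m * (pd 0 (pd 0 α) y / α y) / β y ^ 2 := by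
  have ha := h.scale_ne y hy
  have hb := h.lapse_ne y hy
  rw [xi, dotD_comovingVelocity, h.expansion_warpedMetric hm hy, h.pd_expansion hm hy]
  field_simp
  ring

theorem accel_zero (h : IsWarpedModel W α β γ) (hy : y ∈ W) :
    accel (warpedMetric α β γ) (comovingVelocity β) y 0 = 0 := by
  simp only [accel, covD, Fin.sum_univ_succ, comovingVelocity_zero, comovingVelocity_succ,
    lower_zero, lower_succ, h.christoffel_zero_zero_zero hy, zero_mul, mul_zero,
    Finset.sum_const_zero, add_zero, sub_zero]
  rw [pd_neg, h.indep_lapse.pd_eq_zero]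
  ring

/-- Only `Γ⁰₀_μ` contributes, because `u` has a time component only; the acceleration is the spatial
gradient of `log β`. -/
theorem accel_succ (h : IsWarpedModel W α β γ) (hy : y ∈ W) (μ : Fin m) :
    accel (warpedMetric α β γ) (comovingVelocity β) y μ.succ = pd μ.succ β y / β y := by
  have hb := h.lapse_ne y hy
  simp only [accel, covD, Fin.sum_univ_succ, comovingVelocity_zero, comovingVelocity_succ,
    lower_zero, lower_succ, h.christoffel_zero_zero_succ hy, zero_mul, mul_zero,
    Finset.sum_const_zero, add_zero, pd_const]
  field_simp
  ring

theorem raise_accel_zero (h : IsWarpedModel W α β γ) (hy : y ∈ W) :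
    raise (warpedMetric α β γ) (accel (warpedMetric α β γ) (comovingVelocity β)) y 0 = 0 := by
  simp [raise, Fin.sum_univ_succ, h.metric_inv hy, h.accel_zero hy]

theorem raise_accel_succ (h : IsWarpedModel W α β γ) (hy : y ∈ W) (ρ : Fin m) :
    raise (warpedMetric α β γ) (accel (warpedMetric α β γ) (comovingVelocity β)) y ρ.succ
      = (α y ^ 2)⁻¹ * (lapseGrad β γ ρ y / β y) := by
  simp only [raise, Fin.sum_univ_succ, h.metric_inv hy, h.accel_zero hy, h.accel_succ hy,
    warpedInv_succ_succ, mul_zero, zero_add, lapseGrad, Finset.sum_div, Finset.mul_sum]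
  exact Finset.sum_congr rfl fun ν _ => by ring

/-- The stationary part of the divergence of the acceleration. -/
def accelPart (β : Coord m → ℝ) (γ : Coord m → Matrix (Fin m) (Fin m) ℝ) (y : Coord m) : ℝ :=
  ∑ ρ : Fin m, (pd ρ.succ (fun z => lapseGrad β γ ρ z / β z) y
    + spaceTrace β γ ρ y * (lapseGrad β γ ρ y / β y))

theorem indep_accelPart (h : IsWarpedModel W α β γ) : Indep 0 (accelPart β γ) :=
  Indep.sum fun ρ =>
    have hg := (h.indep_lapseGrad ρ).div h.indep_lapse
    (hg.pd _).add ((h.indep_spaceTrace ρ).mul hg)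

theorem divAccel_warpedMetric (h : IsWarpedModel W α β γ) (hy : y ∈ W) :
    divAccel (warpedMetric α β γ) (comovingVelocity β) y = accelPart β γ y / α y ^ 2 := by
  rw [divAccel, divergence_eq_christoffelTrace]
  have h1 : ∀ ρ : Fin m, pd ρ.succ (fun z => raise (warpedMetric α β γ)
      (accel (warpedMetric α β γ) (comovingVelocity β)) z ρ.succ) y
      = (α y ^ 2)⁻¹ * pd ρ.succ (fun z => lapseGrad β γ ρ z / β z) y := by
    intro ρ
    rw [pd_congr h.isOpen (fun z hz => h.raise_accel_succ hz ρ) hy,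
      h.pd_scale_inv_sq_mul (f := fun z => lapseGrad β γ ρ z / β z) ((h.smooth_lapseGrad ρ).div h.smooth_lapse h.lapse_ne) hy]
  have h0 : pd 0 (fun z => raise (warpedMetric α β γ)
      (accel (warpedMetric α β γ) (comovingVelocity β)) z 0) y = 0 := by
    rw [pd_congr h.isOpen (fun z hz => h.raise_accel_zero hz) hy, pd_const]
  simp only [Fin.sum_univ_succ, h0, h1, h.raise_accel_zero hy, h.raise_accel_succ hy,
    h.christoffelTrace_succ hy, mul_zero, zero_add]
  rw [← Finset.sum_add_distrib, accelPart, Finset.sum_div]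
  exact Finset.sum_congr rfl fun ρ _ => by ring

/-- A quantity that is stationary after multiplication by the squared scale factor. -/
theorem pd_of_scale_sq_mul (h : IsWarpedModel W α β γ) {f k : Coord m → ℝ}
    (hf : ContDiffOn ℝ ∞ f W) (hk : Indep 0 k) (hfk : ∀ z ∈ W, f z = k z / α z ^ 2)
    (hy : y ∈ W) : pd 0 f y = -2 * (pd 0 α y / α y) * f y := by
  have ha := h.scale_ne y hy
  -- Differentiating `α² f = k` instead of the quotient gives `2αα′f + α²f′ = 0`.
  have h1 : pd 0 (fun z => α z ^ 2 * f z) y = pd 0 k y := by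
    refine pd_congr h.isOpen (fun z hz => ?_) hy 0
    rw [hfk z hz, mul_div_cancel₀ _ (pow_ne_zero 2 (h.scale_ne z hz))]
  rw [pd_mul ((h.diff_scale hy).fun_pow 2) (differentiableAt_of_smoothOn h.isOpen hf hy),
    pd_sq (h.diff_scale hy), hk.pd_eq_zero] at h1
  field_simp
  refine mul_left_cancel₀ ha ?_
  linear_combination h1

/-- In the time direction `u₀ = -β` undoes the factor `β⁻¹` of the dot and nothing is claimed. In
the space directions `∂_μ(ξβ²) = 0` is the statement, since `u̇_μ = ∂_μβ/β`. -/
theorem pd_xi (hm : 1 ≤ m) (h : IsWarpedModel W α β γ) (hy : y ∈ W) (k : Fin (m + 1)) :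
    pd k (xi (warpedMetric α β γ) (comovingVelocity β)) y
      = -lower (warpedMetric α β γ) (comovingVelocity β) y k
          * dotD (comovingVelocity β) (xi (warpedMetric α β γ) (comovingVelocity β)) y
        - 2 * accel (warpedMetric α β γ) (comovingVelocity β) y k
          * xi (warpedMetric α β γ) (comovingVelocity β) y := by
  have hb := h.lapse_ne y hy
  have hξ := smoothOn_xi h.isOpen h.metric_smooth h.metric_det h.velocity_smooth
  refine Fin.cases ?_ (fun μ => ?_) k
  · rw [lower_zero, dotD_comovingVelocity, h.accel_zero hy]
    field_simp
    ring
  · rw [lower_succ, h.accel_succ hy]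
    have hi : Indep μ.succ (fun z => (m : ℝ) * (pd 0 (pd 0 α) z / α z)) :=
      (Indep.const _).mul ((((h.indep_scale μ).pd 0).pd 0).div (h.indep_scale μ))
    have h1 : pd μ.succ (fun z => xi (warpedMetric α β γ) (comovingVelocity β) z * β z ^ 2) y
        = pd μ.succ (fun z => (m : ℝ) * (pd 0 (pd 0 α) z / α z)) y := by
      refine pd_congr h.isOpen (fun z hz => ?_) hy _
      rw [h.xi_warpedMetric hm hz, div_mul_cancel₀ _ (pow_ne_zero 2 (h.lapse_ne z hz))]
    rw [hi.pd_eq_zero, pd_mul (differentiableAt_of_smoothOn h.isOpen hξ hy)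
      ((h.diff_lapse hy).fun_pow 2), pd_sq (h.diff_lapse hy)] at h1
    field_simp
    refine mul_left_cancel₀ hb ?_
    linear_combination h1

/-- Raising the index of the stationary covector `u̇` brings in `α⁻²`, so the divergence is
stationary up to that factor. -/
theorem dotD_divAccel (hm : 1 ≤ m) (h : IsWarpedModel W α β γ) (hy : y ∈ W) :
    dotD (comovingVelocity β) (divAccel (warpedMetric α β γ) (comovingVelocity β)) y
      = -2 * expansion (warpedMetric α β γ) (comovingVelocity β) y
        * divAccel (warpedMetric α β γ) (comovingVelocity β) y := by
  rw [dotD_comovingVelocity, h.pd_of_scale_sq_mul (smoothOn_divAccel h.isOpen h.metric_smooth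
    h.metric_det h.velocity_smooth) h.indep_accelPart (fun z hz => h.divAccel_warpedMetric hz) hy,
    h.expansion_warpedMetric hm hy]
  ring

theorem dotD_scalarCurv (hm : 1 ≤ m) (h : IsWarpedModel W α β γ) (hy : y ∈ W) :
    dotD (comovingVelocity β) (scalarCurv (warpedMetric α β γ)) y
        - 2 * dotD (comovingVelocity β) (xi (warpedMetric α β γ) (comovingVelocity β)) y
      = -2 * expansion (warpedMetric α β γ) (comovingVelocity β) y
        * (scalarCurv (warpedMetric α β γ) y
          - ((m : ℝ) + 1) * xi (warpedMetric α β γ) (comovingVelocity β) y) := by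
  have ha := h.scale_ne y hy
  have hb := h.lapse_ne y hy
  have hR := smoothOn_scalarCurv h.isOpen h.metric_smooth h.metric_det
  have hξ := smoothOn_xi h.isOpen h.metric_smooth h.metric_det h.velocity_smooth
  have hφ := smoothOn_expansion h.isOpen h.metric_smooth h.metric_det h.velocity_smooth
  have hξφ : xi (warpedMetric α β γ) (comovingVelocity β) y
      = m * (expansion (warpedMetric α β γ) (comovingVelocity β) y ^ 2
        + (β y)⁻¹ * pd 0 (expansion (warpedMetric α β γ) (comovingVelocity β)) y) := by
    rw [xi, dotD_comovingVelocity]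
  have hφy := h.expansion_warpedMetric hm hy
  -- The combination `R - 2ξ - m(m-1)φ²` removes every term of `R` that is not `α⁻²` times a
  -- stationary function.
  have hscal : ∀ z ∈ W, scalarCurv (warpedMetric α β γ) z
      + (-2 * xi (warpedMetric α β γ) (comovingVelocity β) z
        + -(m * (m - 1)) * expansion (warpedMetric α β γ) (comovingVelocity β) z ^ 2)
      = scalarPart β γ z / α z ^ 2 := by
    intro z hz
    rw [h.scalarCurv_warpedMetric hz, h.xi_warpedMetric hm hz, h.expansion_warpedMetric hm hz]
    ring
  have hpd := h.pd_of_scale_sq_mul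
    (hR.add ((contDiffOn_const.mul hξ).add (contDiffOn_const.mul (hφ.pow 2))))
    h.indep_scalarPart hscal hy
  have dR := differentiableAt_of_smoothOn h.isOpen hR hy
  have dξ := differentiableAt_of_smoothOn h.isOpen hξ hy
  have dφ := differentiableAt_of_smoothOn h.isOpen hφ hy
  rw [pd_add dR (((differentiableAt_const _).fun_mul dξ).fun_add
      ((differentiableAt_const _).fun_mul (dφ.fun_pow 2))),
    pd_add ((differentiableAt_const _).fun_mul dξ)
      ((differentiableAt_const _).fun_mul (dφ.fun_pow 2)),
    pd_mul (differentiableAt_const _) dξ, pd_mul (differentiableAt_const _) (dφ.fun_pow 2),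
    pd_sq dφ, pd_const, pd_const] at hpd
  have hαφ : pd 0 α y / α y
      = β y * expansion (warpedMetric α β γ) (comovingVelocity β) y := by
    rw [hφy]; field_simp
  rw [hαφ] at hpd
  rw [dotD_comovingVelocity, dotD_comovingVelocity]
  -- The rest is algebra: `ξ` at the point is eliminated in favour of `φ` and `∂₀φ`, while the
  -- derivatives of `R` and `ξ` stay as unknowns.
  generalize expansion (warpedMetric α β γ) (comovingVelocity β) y = φ at *
  generalize xi (warpedMetric α β γ) (comovingVelocity β) y = ξ at *
  generalize pd 0 (expansion (warpedMetric α β γ) (comovingVelocity β)) y = φ' at *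
  subst hξφ
  field_simp
  -- The substituted `ξ` leaves `β · β⁻¹` in `hpd`; the last summand replaces it by 1.
  linear_combination hpd + 4 * φ * m * φ' * mul_inv_cancel₀ hb

end IsWarpedModel

/-! ### Transition maps between charts and components of `g` and `u` -/

theorem fderiv_apply_eq_sum {m : ℕ} {z : Coord m} {F : Coord m → Coord m} (hF : DifferentiableAt ℝ F z)
    (i : Fin (m + 1)) : fderiv ℝ F z (basisVec i) = ∑ a, jac F z a i • basisVec a := by
  rw [← sum_smul_basisVec (fderiv ℝ F z (basisVec i))]
  simp only [jac_eq hF]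

section Charts

variable {m : ℕ} {M : Type*} [TopologicalSpace M] {e e' : OpenPartialHomeomorph M (Coord m)}
  {z : Coord m}

/-- The change of coordinates from the chart `e` to the chart `e'`. -/
def transition (e e' : OpenPartialHomeomorph M (Coord m)) (z : Coord m) : Coord m :=
  e' (e.symm z)

/-- The coordinates in the chart `e` of the points that the charts `e` and `e'` both cover. -/
def overlap (e e' : OpenPartialHomeomorph M (Coord m)) : Set (Coord m) :=
  e.target ∩ e.symm ⁻¹' e'.source

theorem isOpen_overlap : IsOpen (overlap e e') :=
  e.symm.isOpen_inter_preimage e'.open_source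

theorem mapsTo_transition : Set.MapsTo (transition e e') (overlap e e') (overlap e' e) := by
  intro z hz
  refine ⟨e'.map_source hz.2, ?_⟩
  change e'.symm (e' (e.symm z)) ∈ e.source
  rw [e'.left_inv hz.2]
  exact e.map_target hz.1

theorem transition_transition (hz : z ∈ overlap e e') :
    transition e' e (transition e e' z) = z := by
  simp only [transition, e'.left_inv hz.2, e.right_inv hz.1]

theorem symm_transition (hz : z ∈ overlap e e') : e'.symm (transition e e' z) = e.symm z :=
  e'.left_inv hz.2

variable [ChartedSpace (Coord m) M]

theorem smoothOn_transition (he : e ∈ IsManifold.maximalAtlas 𝓘(ℝ, Coord m) ∞ M)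
    (he' : e' ∈ IsManifold.maximalAtlas 𝓘(ℝ, Coord m) ∞ M) :
    ContDiffOn ℝ ∞ (transition e e') (overlap e e') := by
  rw [← contMDiffOn_iff_contDiffOn]
  exact (contMDiffOn_of_mem_maximalAtlas he').comp
    ((contMDiffOn_symm_of_mem_maximalAtlas he).mono Set.inter_subset_left) fun _ hz => hz.2

theorem differentiableAt_transition (he : e ∈ IsManifold.maximalAtlas 𝓘(ℝ, Coord m) ∞ M)
    (he' : e' ∈ IsManifold.maximalAtlas 𝓘(ℝ, Coord m) ∞ M) (hz : z ∈ overlap e e') :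
    DifferentiableAt ℝ (transition e e') z :=
  ((smoothOn_transition he he').contDiffAt (isOpen_overlap.mem_nhds hz)).differentiableAt (by simp)

theorem mdifferentiableAt_chart (he : e ∈ IsManifold.maximalAtlas 𝓘(ℝ, Coord m) ∞ M) {x : M}
    (hx : x ∈ e.source) : MDifferentiableAt 𝓘(ℝ, Coord m) 𝓘(ℝ, Coord m) e x :=
  ((contMDiffOn_of_mem_maximalAtlas he).contMDiffAt (e.open_source.mem_nhds hx)).mdifferentiableAt
    (by simp)

theorem mdifferentiableAt_chart_symm (he : e ∈ IsManifold.maximalAtlas 𝓘(ℝ, Coord m) ∞ M)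
    (hz : z ∈ e.target) : MDifferentiableAt 𝓘(ℝ, Coord m) 𝓘(ℝ, Coord m) e.symm z :=
  ((contMDiffOn_symm_of_mem_maximalAtlas he).contMDiffAt
    (e.open_target.mem_nhds hz)).mdifferentiableAt (by simp)

/-- The two transition maps are mutually inverse, so by the chain rule the product of their
Jacobians is the identity. -/
theorem det_jac_transition_ne_zero (he : e ∈ IsManifold.maximalAtlas 𝓘(ℝ, Coord m) ∞ M)
    (he' : e' ∈ IsManifold.maximalAtlas 𝓘(ℝ, Coord m) ∞ M) (hz : z ∈ overlap e e') :
    (jac (transition e e') z).det ≠ 0 := by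
  have hd := differentiableAt_transition he he' hz
  have hd' := differentiableAt_transition he' he (mapsTo_transition hz)
  have hmul : jac (transition e' e) (transition e e' z) * jac (transition e e') z = 1 := by
    ext a i
    rw [Matrix.mul_apply]
    have h1 := pd_comp (h := fun w => transition e' e w a) hd (differentiableAt_coord hd' a) i
    rw [pd_congr isOpen_overlap (g := fun w => w a)
      (fun w hw => by rw [transition_transition hw]) hz] at h1
    have h2 : jac (fun w : Coord m => w) z a i = (1 : Matrix (Fin (m + 1)) (Fin (m + 1)) ℝ) a i := by
      rw [jac_eq differentiableAt_fun_id, fderiv_fun_id]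
      simp [basisVec, Matrix.one_apply]
    rw [← h2]
    exact h1.symm
  intro h0
  have := congrArg Matrix.det hmul
  rw [Matrix.det_mul, h0, mul_zero, Matrix.det_one] at this
  exact zero_ne_one this

/-- A coordinate vector as a vector of the model space. -/
def coordVec' (e : OpenPartialHomeomorph M (Coord m)) (y : Coord m) (i : Fin (m + 1)) : Coord m :=
  coordVec e y i

/-- The chain rule for `e.symm = e'.symm ∘ transition e e'`, which holds near `z`. -/
theorem coordVec_transition (he : e ∈ IsManifold.maximalAtlas 𝓘(ℝ, Coord m) ∞ M)
    (he' : e' ∈ IsManifold.maximalAtlas 𝓘(ℝ, Coord m) ∞ M) (hz : z ∈ overlap e e')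
    (i : Fin (m + 1)) :
    coordVec' e z i
      = ∑ a, jac (transition e e') z a i • coordVec' e' (transition e e' z) a := by
  have hd := differentiableAt_transition he he' hz
  have h1 : (e'.symm ∘ transition e e') =ᶠ[nhds z] e.symm :=
    Filter.eventuallyEq_of_mem (isOpen_overlap.mem_nhds hz) fun w hw => symm_transition hw
  have h2 := (mdifferentiableAt_chart_symm he' (mapsTo_transition hz).1).hasMFDerivAt.comp z
    hd.hasFDerivAt.hasMFDerivAt
  have h3 := (h2.congr_of_eventuallyEq h1.symm).mfderiv
  have h4 : coordVec' e z i = (mfderiv 𝓘(ℝ, Coord m) 𝓘(ℝ, Coord m) e'.symm (transition e e' z) :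
      Coord m →L[ℝ] Coord m) (fderiv ℝ (transition e e') z (basisVec i)) := by
    unfold coordVec' coordVec
    rw [h3]
    rfl
  have hL : ∀ L : Coord m →L[ℝ] Coord m, L (fderiv ℝ (transition e e') z (basisVec i))
      = ∑ a, jac (transition e e') z a i • L (basisVec a) := by
    intro L
    rw [fderiv_apply_eq_sum hd, map_sum]
    simp only [map_smul]
  exact h4.trans (hL _)

theorem vecComp_transition {u : (x : M) → TangentSpace 𝓘(ℝ, Coord m) x}
    (he : e ∈ IsManifold.maximalAtlas 𝓘(ℝ, Coord m) ∞ M)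
    (he' : e' ∈ IsManifold.maximalAtlas 𝓘(ℝ, Coord m) ∞ M) (hz : z ∈ overlap e e')
    (a : Fin (m + 1)) :
    vecComp u e' (transition e e' z) a
      = ∑ i, jac (transition e e') z a i * vecComp u e z i := by
  have hd := differentiableAt_transition he he' hz
  have hx : e.symm z ∈ e.source := e.map_target hz.1
  have hez : e (e.symm z) = z := e.right_inv hz.1
  have h1 : (transition e e' ∘ e) =ᶠ[nhds (e.symm z)] e' :=
    Filter.eventuallyEq_of_mem (e.open_source.mem_nhds hx) fun w hw => by
      simp only [Function.comp, transition, e.left_inv hw]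
  have hd2 : HasMFDerivAt 𝓘(ℝ, Coord m) 𝓘(ℝ, Coord m) (transition e e') (e (e.symm z))
      (fderiv ℝ (transition e e') z) := by
    rw [hez]; exact hd.hasFDerivAt.hasMFDerivAt
  have h2 := hd2.comp (e.symm z) (mdifferentiableAt_chart he hx).hasMFDerivAt
  have h3 := (h2.congr_of_eventuallyEq h1.symm).mfderiv
  -- The two base points are equal only propositionally and the tangent space depends on the point;
  -- quantifying over `x` lets the equality be substituted.
  have h4 : ∀ x, x = e.symm z → (show Coord m from
      mfderiv 𝓘(ℝ, Coord m) 𝓘(ℝ, Coord m) e' x (u x))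
      = fderiv ℝ (transition e e') z (show Coord m from
        mfderiv 𝓘(ℝ, Coord m) 𝓘(ℝ, Coord m) e (e.symm z) (u (e.symm z))) := by
    rintro x rfl
    rw [h3]
    rfl
  unfold vecComp
  rw [h4 _ (symm_transition hz)]
  set v : Coord m := mfderiv 𝓘(ℝ, Coord m) 𝓘(ℝ, Coord m) e (e.symm z) (u (e.symm z))
  change (fderiv ℝ (transition e e') z v) a = ∑ i, jac (transition e e') z a i * v i
  conv_lhs => rw [← sum_smul_basisVec v, map_sum]
  simp only [map_smul, jac_eq hd]
  simp [mul_comm]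

variable [IsManifold 𝓘(ℝ, Coord m) ∞ M] {g : LorentzianMetric (m := m) M}

/-- The scalar product at `x` on the model space. -/
def inner' (g : LorentzianMetric (m := m) M) (x : M) : Coord m →L[ℝ] Coord m →L[ℝ] ℝ :=
  g.inner x

theorem metricComp_eq (y : Coord m) (i j : Fin (m + 1)) :
    metricComp g e y i j = inner' g (e.symm y) (coordVec' e y i) (coordVec' e y j) := rfl

theorem metricComp_transition (he : e ∈ IsManifold.maximalAtlas 𝓘(ℝ, Coord m) ∞ M)
    (he' : e' ∈ IsManifold.maximalAtlas 𝓘(ℝ, Coord m) ∞ M) (hz : z ∈ overlap e e') :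
    metricComp g e z = (jac (transition e e') z).transpose
      * metricComp g e' (transition e e' z) * jac (transition e e') z := by
  ext i j
  rw [metricComp_eq, coordVec_transition he he' hz i, coordVec_transition he he' hz j]
  simp only [map_sum, map_smul, sum_apply, smul_apply,
    Matrix.mul_apply, Matrix.transpose_apply, metricComp_eq, symm_transition hz, smul_eq_mul,
    Finset.sum_mul, Finset.mul_sum]
  refine Finset.sum_congr rfl fun a _ => Finset.sum_congr rfl fun b _ => ?_
  ring

end Charts

/-! ### Comoving charts as warped models, and the theorem -/

theorem indep_zero_spatial {m : ℕ} {X : Type*} (f : (Fin m → ℝ) → X) :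
    Indep 0 (fun y : Coord m => f (spatial y)) := by
  intro y s
  change f (spatial _) = f (spatial y)
  congr 1
  ext μ
  simp [spatial, basisVec]

theorem indep_succ_time {m : ℕ} {X : Type*} (f : ℝ → X) (μ : Fin m) :
    Indep μ.succ (fun y : Coord m => f (y 0)) := by
  intro y s
  change f _ = f (y 0)
  congr 1
  simp [basisVec]

end DoublyWarped

open DoublyWarped in
theorem mainTheorem8 {m : ℕ} (hm : 1 ≤ m) {M : Type*} [TopologicalSpace M]
    [ChartedSpace (DoublyWarped.Coord m) M]
    [IsManifold 𝓘(ℝ, DoublyWarped.Coord m) ∞ M]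
    (g : DoublyWarped.LorentzianMetric (m := m) M)
    (u : (x : M) → TangentSpace 𝓘(ℝ, DoublyWarped.Coord m) x)
    (hDW : DoublyWarped.IsDoublyWarped g u)
    (e : OpenPartialHomeomorph M (DoublyWarped.Coord m))
    (he : e ∈ IsManifold.maximalAtlas 𝓘(ℝ, DoublyWarped.Coord m) ∞ M)
    (y : DoublyWarped.Coord m) (hy : y ∈ e.target) :
    let G := DoublyWarped.metricComp g e
    let U := DoublyWarped.vecComp u e
    let ξ := DoublyWarped.xi G U
    let φ := DoublyWarped.expansion G U
    let R := DoublyWarped.scalarCurv G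
    let n : ℝ := (m : ℝ) + 1
    (∀ k, DoublyWarped.pd k ξ y =
      -DoublyWarped.lower G U y k * DoublyWarped.dotD U ξ y
        - 2 * DoublyWarped.accel G U y k * ξ y) ∧
    DoublyWarped.dotD U (DoublyWarped.divAccel G U) y =
      -2 * φ y * DoublyWarped.divAccel G U y ∧
    DoublyWarped.dotD U R y - 2 * DoublyWarped.dotD U ξ y = -2 * φ y * (R y - n * ξ y) := by
  intro G U ξ φ R n
  obtain ⟨e', he', hx, a, b, gs, ha, hb, hgs, hcom⟩ := hDW (e.symm y)
  have hmodel : IsWarpedModel e'.target (fun z => a (z 0)) (fun z => b (spatial z))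
      (fun z => gs (spatial z)) :=
    { isOpen := e'.open_target
      smooth_scale := ha
      smooth_lapse := hb
      smooth_space := hgs
      indep_scale := indep_succ_time a
      indep_lapse := indep_zero_spatial b
      indep_space := indep_zero_spatial gs
      scale_ne := fun z hz => (hcom z hz).1.ne'
      lapse_ne := fun z hz => (hcom z hz).2.1.ne'
      space_symm := fun z hz => by
        rw [Matrix.IsSymm, ← Matrix.conjTranspose_eq_transpose_of_trivial,
          (hcom z hz).2.2.1.isHermitian.eq]
      space_det := fun z hz => (hcom z hz).2.2.1.det_pos.ne' }
  set α : Coord m → ℝ := fun z => a (z 0)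
  set β : Coord m → ℝ := fun z => b (spatial z)
  set γ : Coord m → Matrix (Fin m) (Fin m) ℝ := fun z => gs (spatial z)
  have hV : y ∈ overlap e e' := ⟨hy, hx⟩
  -- The given chart plays the role of the source and the comoving chart that of the target, so
  -- every quantity in `e` is expressed by its explicit comoving value.
  have hpull : IsPullback (transition e e') (overlap e e') e'.target G (warpedMetric α β γ) :=
    { isOpen_left := isOpen_overlap
      isOpen_right := e'.open_target
      smooth := smoothOn_transition he he'
      mapsTo := fun z hz => (mapsTo_transition hz).1
      det_jac := fun z hz => det_jac_transition_ne_zero he he' hz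
      metric_smooth := hmodel.metric_smooth
      metric_symm := hmodel.metric_symm
      metric_det := hmodel.metric_det
      metric_eq := fun z hz => by
        rw [show G z = _ from metricComp_transition he he' hz,
          (hcom _ (mapsTo_transition hz).1).2.2.2.1]
        rfl }
  have hUU : ∀ z ∈ overlap e e',
      col (comovingVelocity β) (transition e e' z) = jac (transition e e') z * col U z := by
    intro z hz
    ext i _
    rw [Matrix.mul_apply]
    refine Eq.trans ?_ (vecComp_transition he he' hz i)
    rw [(hcom _ (mapsTo_transition hz).1).2.2.2.2]
    rfl
  have hU := hmodel.velocity_smooth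
  have hF : transition e e' y ∈ e'.target := hpull.mapsTo hV
  have hξs := smoothOn_xi hmodel.isOpen hmodel.metric_smooth hmodel.metric_det hU
  -- `ξ`, `R` and `∇ₚu̇ᵖ` get differentiated, so their invariance is needed on the whole overlap;
  -- for `φ` the point itself is enough.
  have hξ : ∀ z ∈ overlap e e', ξ z = _ := fun z hz => hpull.xi_eq hU hUU hz
  have hφ : φ y = _ := hpull.expansion_eq hU hUU hV
  have hR : ∀ z ∈ overlap e e', R z = _ := fun z hz => hpull.scalarCurv_eq hz
  have hA : ∀ z ∈ overlap e e', divAccel G U z = _ := fun z hz => hpull.divAccel_eq hU hUU hz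
  refine ⟨fun k => ?_, ?_, ?_⟩
  · have hlow := congrFun (congrFun (hpull.lower_eq hUU hV) k) ()
    rw [Matrix.mul_apply] at hlow
    change lower G U y k = ∑ b, jac (transition e e') y b k
      * lower (warpedMetric α β γ) (comovingVelocity β) (transition e e' y) b at hlow
    rw [hpull.pd_eq hξs hξ hV, hpull.dotD_eq hUU hξs hξ hV, hξ y hV, hlow,
      hpull.accel_eq hU hUU hV]
    -- The first identity is between covectors: it is the comoving one contracted with column `k` of
    -- the Jacobian.
    simp only [hmodel.pd_xi hm hF, Finset.mul_sum, Finset.sum_mul, ← Finset.sum_neg_distrib]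
    rw [← Finset.sum_sub_distrib]
    exact Finset.sum_congr rfl fun b _ => by ring
  · rw [hpull.dotD_eq hUU (smoothOn_divAccel hmodel.isOpen hmodel.metric_smooth
      hmodel.metric_det hU) hA hV, hφ, hA y hV]
    exact hmodel.dotD_divAccel hm hF
  · rw [hpull.dotD_eq hUU (smoothOn_scalarCurv hmodel.isOpen hmodel.metric_smooth
      hmodel.metric_det) hR hV, hpull.dotD_eq hUU hξs hξ hV, hφ, hR y hV, hξ y hV]
    exact hmodel.dotD_scalarCurv hm hF

end
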